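/- **Setting.** Let $\mathcal A_1,\mathcal A_2$ be finite nonempty action sets of players $P_1,P_2$. A game is a pair $G=(U_1,U_2)$ of utility functions $U_i(\cdot,\cdot;G):\mathcal A_1\times\mathcal A_2\to\mathbb R$, extended bilinearly to mixed strategies. An action $a_0$ of $P_1$ is weakly dominated in $G$ if some $\mathbf x\in\Delta(\mathcal A_1\setminus\{a_0\})$ satisfies $U_1(\mathbf x,b;G)\ge U_1(a_0,b;G)$ for all $b\in\mathcal A_2$; symmetrically for $P_2$. The (optimistic) Stackelberg value of $P_2$ is $$\mathrm{StackVal}_2(G)=\max_{\mathbf y\in\Delta(\mathcal A_2)}\ \max_{a\in\mathrm{BR}_1(\mathbf y;G)}U_2(a,\mathbf y;G),\qquad \mathrm{BR}_1(\mathbf y;G)=\operatorname{argmax}_{a\in\mathcal A_1}U_1(a,\mathbf y;G).$$ Let $\mathcal G$ be a family of games and $\mathcal D$ a discrete prior on $\mathcal G$ under which all utilities are integrable, and let $p_1,p_2\in[0,1]$. A game $G\sim\mathcal D$ is drawn once and then played repeatedly. Given $G$, the players privately receive independent initial signals $s_1,s_2\in\mathcal G$, where $s_i=s$ with probability $p_i\mathbf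 1\{s=G\}+(1-p_i)\mathcal D(s)$. In addition, for every $G\in\mathcal G$ there is a sequence of distributions $Q_G^1,Q_G^2,\dots$ on $\mathcal G$; when $G$ is realized, $P_2$ privately receives in round $t$ an external signal $q^t\sim Q_G^t$, drawn independently of everything before. The external signals *successfully learn* $G$ if $\Pr_{q\sim Q_G^t}[q\ne G]\to 0$ as $t\to\infty$. In round $t$ the players simultaneously choose mixed strategies $\mathbf x^t,\mathbf y^t$. Afterwards each player observes her own strategy and her own utility $U_i(\mathbf x^t,\mathbf y^t;G)$ and, under *full-information feedback*, also the strategy of the opponent; under *bandit feedback* nothing else. An algorithm $\pi_1$ of $P_1$ maps, for every round $t$, the signal $s_1$ and her feedback from the earlier rounds to a distribution from which $\mathbf x^t$ is drawn; an algorithm $\pi_2$ of $P_2$ maps $s_2$, her feedback from the earlier rounds and $q^t$ to a distribution from which $\mathbf y^t$ is drawn (the players' draws are independent). Let $\bar U_i^T(\pi_1,\pi_2;G)=\mathbb E\big[\frac1T\sum_{t=1}^T U_i(\mathbf x^t,\mathbf y^t;G)\big]$ when $G$ is realized, and $\bar U_i^T(\pi_1,\pi_2;\mathcal D)=\mathbb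 E_{G\sim\mathcal D}\bar U_i^T(\pi_1,\pi_2;G)$. The pair $(\pi_1,\pi_2)$ is a *pure Nash equilibrium (PNE) of the meta-game* if, for each player $i$ and every deviation $\pi_i'$ (even one that depends on the horizon $T$), $$\limsup_{T\to\infty}\big(\bar U_i^T(\pi_i',\pi_{-i};\mathcal D)-\bar U_i^T(\pi_i,\pi_{-i};\mathcal D)\big)\le 0 .$$ **Proposition.** Consider either of the two feedback models. Suppose that no game in the support of $\mathcal D$ has a weakly dominated action for either player, and that $P_2$ can successfully learn independently: the external signals successfully learn every $G$ in the support of $\mathcal D$. Then there is a pair of algorithms $(\pi_1,\pi_2)$, not depending on the horizon $T$, that is a PNE of the meta-game and satisfies $$\bar U_2^T(\pi_1,\pi_2;G)\ \ge\ \mathrm{StackVal}_2(G)-o_T(1)$$ for every $G$ in the support of $\mathcal D$, and more generally for every $G\in\mathcal G$ that has no weakly dominated action and that the external signals successfully learn. No relation between $p_1$ and $p_2$ is assumed, so, by exchanging the names of the players, the result holds for either player as the learner. -/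

import Mathlib

open MeasureTheory ProbabilityTheory Filter Topology

universe u v

/-- A two-player game with action sets `A₁`, `A₂` and utility functions `U₁`, `U₂`. -/
structure BimatrixGame (A₁ : Type u) (A₂ : Type v) where
  U₁ : A₁ → A₂ → ℝ
  U₂ : A₁ → A₂ → ℝ

/-- Games are signals, which are discrete objects: every set of games is measurable. -/
instance instMeasurableSpaceBimatrixGame {A₁ : Type u} {A₂ : Type v} :
    MeasurableSpace (BimatrixGame A₁ A₂) := ⊤

/-- The mixed strategies over a finite action set. -/
abbrev MixedStrategy (A : Type u) [Fintype A] : Type u := stdSimplex ℝ A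

/-- The expected utility `E_{a ∼ x, b ∼ y} [w a b]`. -/
def mixedUtility {A₁ : Type u} {A₂ : Type v} [Fintype A₁] [Fintype A₂] (w : A₁ → A₂ → ℝ)
    (x : MixedStrategy A₁) (y : MixedStrategy A₂) : ℝ :=
  ∑ a, ∑ b, x.1 a * y.1 b * w a b

namespace BimatrixGame

variable {A₁ : Type u} {A₂ : Type v} [Fintype A₁] [Fintype A₂]

/-- The action `a₀` of the first player is weakly dominated: some mixed strategy that does not use
`a₀` is at least as good against every action of the second player. -/
def WeaklyDominated₁ (G : BimatrixGame A₁ A₂) (a₀ : A₁) : Prop :=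
  ∃ x : MixedStrategy A₁, x.1 a₀ = 0 ∧ ∀ b, G.U₁ a₀ b ≤ ∑ a, x.1 a * G.U₁ a b

/-- The action `b₀` of the second player is weakly dominated. -/
def WeaklyDominated₂ (G : BimatrixGame A₁ A₂) (b₀ : A₂) : Prop :=
  ∃ y : MixedStrategy A₂, y.1 b₀ = 0 ∧ ∀ a, G.U₂ a b₀ ≤ ∑ b, y.1 b * G.U₂ a b

/-- Neither player has a weakly dominated action. -/
def NoWeaklyDominatedAction (G : BimatrixGame A₁ A₂) : Prop :=
  (∀ a, ¬ G.WeaklyDominated₁ a) ∧ ∀ b, ¬ G.WeaklyDominated₂ b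

/-- The best responses (actions) of the first player to a mixed strategy of the second player. -/
def bestResponse₁ (G : BimatrixGame A₁ A₂) (y : MixedStrategy A₂) : Set A₁ :=
  {a | ∀ a', ∑ b, y.1 b * G.U₁ a' b ≤ ∑ b, y.1 b * G.U₁ a b}

/-- The optimistic Stackelberg value of the second player: the largest utility she can get by
committing to a mixed strategy, the first player answering with a best response and breaking ties
in her favour. -/
noncomputable def stackVal₂ (G : BimatrixGame A₁ A₂) : ℝ :=
  sSup {v | ∃ y : MixedStrategy A₂, ∃ a ∈ G.bestResponse₁ y, v = ∑ b, y.1 b * G.U₂ a b}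

end BimatrixGame

/-- What a player sees of the opponent's play: her mixed strategies (`full`) or nothing
(`bandit`). In both cases a player sees her own strategies and her own realized utilities. -/
inductive Feedback
  | full
  | bandit

/-- What is seen of an opponent's strategy that lives in `O`. -/
def Feedback.Seen : Feedback → Type u → Type u
  | .full, O => O
  | .bandit, _ => PUnit

/-- The part of the opponent's strategy that is seen. -/
def Feedback.see {O : Type u} : (fb : Feedback) → O → fb.Seen O
  | .full, o => o
  | .bandit, _ => PUnit.unit

instance instMeasurableSpaceSeen {O : Type u} [mO : MeasurableSpace O] :
    (fb : Feedback) → MeasurableSpace (fb.Seen O)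
  | .full => mO
  | .bandit => (⊤ : MeasurableSpace PUnit)

/-- The feedback after one round: own strategy, what is seen of the opponent's strategy, own
realized utility. -/
abbrev Observation (fb : Feedback) (Own : Type u) (Opp : Type v) : Type (max u v) :=
  Own × fb.Seen Opp × ℝ

section Algorithms

variable {A₁ : Type u} {A₂ : Type v} [Fintype A₁] [Fintype A₂]

/-- The first `t` feedbacks of the first player along a history of strategy pairs in the game
`G`. -/
def observations₁ (fb : Feedback) (G : BimatrixGame A₁ A₂) {t : ℕ}
    (h : Fin t → MixedStrategy A₁ × MixedStrategy A₂) :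
    Fin t → Observation fb (MixedStrategy A₁) (MixedStrategy A₂) :=
  fun r => ((h r).1, fb.see (h r).2, mixedUtility G.U₁ (h r).1 (h r).2)

/-- The first `t` feedbacks of the second player. -/
def observations₂ (fb : Feedback) (G : BimatrixGame A₁ A₂) {t : ℕ}
    (h : Fin t → MixedStrategy A₁ × MixedStrategy A₂) :
    Fin t → Observation fb (MixedStrategy A₂) (MixedStrategy A₁) :=
  fun r => ((h r).2, fb.see (h r).1, mixedUtility G.U₂ (h r).1 (h r).2)

/-- An algorithm of the first player: at every round it maps her signal and the feedback of the
earlier rounds to a distribution from which her next mixed strategy is drawn. -/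
structure Algorithm₁ (fb : Feedback) (𝒢 : Set (BimatrixGame A₁ A₂)) where
  next : 𝒢 → (t : ℕ) →
    Kernel (Fin t → Observation fb (MixedStrategy A₁) (MixedStrategy A₂)) (MixedStrategy A₁)
  isMarkov : ∀ s t, IsMarkovKernel (next s t)

/-- An algorithm of the second player, who also receives an external signal at every round: it maps
her initial signal, the feedback of the earlier rounds and the current external signal to a
distribution from which her next mixed strategy is drawn. -/
structure Algorithm₂ (fb : Feedback) (𝒢 : Set (BimatrixGame A₁ A₂)) where
  next : 𝒢 → (t : ℕ) →
    Kernel ((Fin t → Observation fb (MixedStrategy A₂) (MixedStrategy A₁)) × 𝒢) (MixedStrategy A₂)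
  isMarkov : ∀ s t, IsMarkovKernel (next s t)

lemma measurable_see {O : Type u} [MeasurableSpace O] (fb : Feedback) :
    Measurable (fb.see : O → fb.Seen O) := by
  cases fb
  · exact measurable_id
  · exact measurable_const

lemma measurable_mixedUtility (w : A₁ → A₂ → ℝ) :
    Measurable fun z : MixedStrategy A₁ × MixedStrategy A₂ => mixedUtility w z.1 z.2 := by
  unfold mixedUtility
  refine Finset.measurable_sum _ fun a _ => Finset.measurable_sum _ fun b _ => ?_
  exact ((((measurable_pi_apply a).comp measurable_subtype_coe).comp measurable_fst).mul
    (((measurable_pi_apply b).comp measurable_subtype_coe).comp measurable_snd)).mul_const _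

lemma measurable_observations₁ (fb : Feedback) (G : BimatrixGame A₁ A₂) {t : ℕ} :
    Measurable (observations₁ fb G (t := t)) := by
  refine measurable_pi_lambda _ fun r => ?_
  have hr : Measurable fun h : Fin t → MixedStrategy A₁ × MixedStrategy A₂ => h r :=
    measurable_pi_apply r
  exact hr.fst.prodMk (((measurable_see fb).comp hr.snd).prodMk
    ((measurable_mixedUtility G.U₁).comp hr))

lemma measurable_observations₂ (fb : Feedback) (G : BimatrixGame A₁ A₂) {t : ℕ} :
    Measurable (observations₂ fb G (t := t)) := by
  refine measurable_pi_lambda _ fun r => ?_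
  have hr : Measurable fun h : Fin t → MixedStrategy A₁ × MixedStrategy A₂ => h r :=
    measurable_pi_apply r
  exact hr.snd.prodMk (((measurable_see fb).comp hr.fst).prodMk
    ((measurable_mixedUtility G.U₂).comp hr))

/-- The law of the strategy pair of round `t` given the earlier strategy pairs, in the game `G` with
initial signals `s₁`, `s₂`: the external signal is a fresh draw from `q t`, and the two players
draw their strategies independently. -/
noncomputable def roundKernel {fb : Feedback} {𝒢 : Set (BimatrixGame A₁ A₂)} (q : ℕ → PMF 𝒢)
    (π₁ : Algorithm₁ fb 𝒢) (π₂ : Algorithm₂ fb 𝒢) (G : BimatrixGame A₁ A₂) (s₁ s₂ : 𝒢) (t : ℕ) :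
    Kernel (Fin t → MixedStrategy A₁ × MixedStrategy A₂) (MixedStrategy A₁ × MixedStrategy A₂) :=
  (π₁.next s₁ t).comap (observations₁ fb G) (measurable_observations₁ fb G) ×ₖ
    (π₂.next s₂ t ∘ₖ
      (Kernel.deterministic (observations₂ fb G) (measurable_observations₂ fb G) ×ₖ
        Kernel.const _ (q t).toMeasure))

/-- The distribution of the trajectory of the first `T` rounds in the game `G` with initial signals
`s₁`, `s₂`. -/
noncomputable def trajectory {fb : Feedback} {𝒢 : Set (BimatrixGame A₁ A₂)} (q : ℕ → PMF 𝒢)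
    (π₁ : Algorithm₁ fb 𝒢) (π₂ : Algorithm₂ fb 𝒢) (G : BimatrixGame A₁ A₂) (s₁ s₂ : 𝒢) :
    (T : ℕ) → Measure (Fin T → MixedStrategy A₁ × MixedStrategy A₂)
  | 0 => Measure.dirac Fin.elim0
  | T + 1 => (trajectory q π₁ π₂ G s₁ s₂ T ⊗ₘ roundKernel q π₁ π₂ G s₁ s₂ T).map
      fun z => Fin.snoc (α := fun _ => MixedStrategy A₁ × MixedStrategy A₂) z.1 z.2

/-- The probability of the initial signal `s` in the game `G`: with probability `p` the signal is
`G`, with probability `1 - p` it is an independent draw from the prior. -/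
noncomputable def signalProb {𝒢 : Set (BimatrixGame A₁ A₂)} (D : PMF 𝒢) (p : unitInterval)
    (G s : 𝒢) : ENNReal :=
  ENNReal.ofReal p * PMF.pure G s + ENNReal.ofReal (1 - p) * D s

/-- The data of a repeated Bayesian game in which the second player receives external signals: a
family of games, a prior, the precisions of the two initial signals, and, for every realized game,
the distributions of the external signals of the successive rounds. -/
structure RepeatedBayesianGame (A₁ : Type u) (A₂ : Type v) where
  family : Set (BimatrixGame A₁ A₂)
  prior : PMF family
  p₁ : unitInterval
  p₂ : unitInterval
  external : family → ℕ → PMF family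

/-- A sequence of beliefs successfully learns `G`: the probability of another game vanishes. -/
def SuccessfullyLearns {𝒢 : Set (BimatrixGame A₁ A₂)} (β : ℕ → PMF 𝒢) (G : 𝒢) : Prop :=
  Tendsto (fun t => (β t).toMeasure {G' | G' ≠ G}) atTop (𝓝 0)

namespace RepeatedBayesianGame

variable (R : RepeatedBayesianGame A₁ A₂) {fb : Feedback}

/-- The distribution of the trajectory of the first `T` rounds in the game `G`: the mixture over the
two initial signals, which are independent given `G`. -/
noncomputable def mixedTrajectory (T : ℕ) (π₁ : Algorithm₁ fb R.family)
    (π₂ : Algorithm₂ fb R.family) (G : R.family) :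
    Measure (Fin T → MixedStrategy A₁ × MixedStrategy A₂) :=
  Measure.sum fun s : R.family × R.family =>
    (signalProb R.prior R.p₁ G s.1 * signalProb R.prior R.p₂ G s.2) •
      trajectory (R.external G) π₁ π₂ G.1 s.1 s.2 T

/-- The expected average utility of the first player over `T` rounds in the game `G`. -/
noncomputable def avgUtility₁ (T : ℕ) (π₁ : Algorithm₁ fb R.family) (π₂ : Algorithm₂ fb R.family)
    (G : R.family) : ℝ :=
  ∫ τ, (1 / (T : ℝ) * ∑ t, mixedUtility G.1.U₁ (τ t).1 (τ t).2) ∂(R.mixedTrajectory T π₁ π₂ G)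

/-- The expected average utility of the second player over `T` rounds in the game `G`. -/
noncomputable def avgUtility₂ (T : ℕ) (π₁ : Algorithm₁ fb R.family) (π₂ : Algorithm₂ fb R.family)
    (G : R.family) : ℝ :=
  ∫ τ, (1 / (T : ℝ) * ∑ t, mixedUtility G.1.U₂ (τ t).1 (τ t).2) ∂(R.mixedTrajectory T π₁ π₂ G)

/-- The payoff of the first player in the meta-game with horizon `T`. -/
noncomputable def metaUtility₁ (T : ℕ) (π₁ : Algorithm₁ fb R.family)
    (π₂ : Algorithm₂ fb R.family) : ℝ :=
  ∑' G, (R.prior G).toReal * R.avgUtility₁ T π₁ π₂ G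

/-- The payoff of the second player in the meta-game with horizon `T`. -/
noncomputable def metaUtility₂ (T : ℕ) (π₁ : Algorithm₁ fb R.family)
    (π₂ : Algorithm₂ fb R.family) : ℝ :=
  ∑' G, (R.prior G).toReal * R.avgUtility₂ T π₁ π₂ G

/-- Utilities are integrable under the prior, so that all payoffs of the meta-game are
well-defined expectations. (This is automatic for a finite family.) -/
def IntegrableUtilities : Prop :=
  (∀ a b, Summable fun G : R.family => (R.prior G).toReal * |G.1.U₁ a b|) ∧
    ∀ a b, Summable fun G : R.family => (R.prior G).toReal * |G.1.U₂ a b|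

/-- A pair of algorithms is a pure Nash equilibrium of the meta-game: as the horizon grows, no player
gains a non-vanishing amount by deviating. The algorithms `π₁`, `π₂` do not know the horizon `T`,
whereas a deviation may depend on it. -/
def IsPNE (π₁ : Algorithm₁ fb R.family) (π₂ : Algorithm₂ fb R.family) : Prop :=
  (∀ π₁' : ℕ → Algorithm₁ fb R.family,
    limsup (fun T : ℕ =>
      ((R.metaUtility₁ T (π₁' T) π₂ - R.metaUtility₁ T π₁ π₂ : ℝ) : EReal)) atTop ≤ 0) ∧
  ∀ π₂' : ℕ → Algorithm₂ fb R.family,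
    limsup (fun T : ℕ =>
      ((R.metaUtility₂ T π₁ (π₂' T) - R.metaUtility₂ T π₁ π₂ : ℝ) : EReal)) atTop ≤ 0

end RepeatedBayesianGame

end Algorithms

/-!
The first player runs regret matching for internal regret, the second player commits to a nearly
optimal Stackelberg strategy for the game that her external signal names.

*The first player.* She keeps importance-weighted estimates `M a a'` of what she would have gained
by playing `a'` whenever regret matching prescribed `a`. She draws a pure strategy from a
distribution that is almost invariant for the Markov chain with rates `max (M a a') 0`, mixed with
a vanishing amount of uniform exploration. Invariance makes the conditional drift of the Blackwell
potential `∑ (max (M a a') 0) ^ 2` bounded up to second moments, so that her expected internal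
regret is `o(T)` in every game and against every opponent, whatever the feedback and without a
known bound on the utilities (`integral_sum_swapGain_le`, `tendsto_regretBound_div`).

*The cap on the second player.* Expected frequencies of pairs of actions without internal regret
are mixtures of pairs of a strategy of the second player and a best response to it, so they give
her at most the Stackelberg value; by compactness small regret gives hardly more
(`BimatrixGame.exists_forall_sum_mul_U₂_le`, `RepeatedBayesianGame.eventually_avgUtility₂_le`).

*The second player.* Let `y` be an optimal commitment and `a` the best response to it that she
hopes for. As `a` is not weakly dominated, it is the unique best response to some strategy `y'`
(`BimatrixGame.exists_unique_bestResponse₁`), hence also to `(1 - ε) y + ε y'`, with a margin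
proportional to `ε`. Both the regret bound of the first player and the error probabilities of the
external signals are determined by the game, so she can let `ε` vanish more slowly than these
(`BimatrixGame.nonempty_commitment`). Small regret then forces the first player to play `a` in
almost all rounds, and the second player gets her Stackelberg value in the limit
(`RepeatedBayesianGame.exists_stackVal₂_sub_le`).

*Equilibrium.* By the cap, the second player cannot gain by deviating. The strategies of the
second player do not react to the first, who therefore cannot do better than a best response in
each round; this is always `a`, and having no regret is as good
(`RepeatedBayesianGame.avgUtility₁_sub_le`). These bounds hold game by game and pass to the prior
by dominated convergence (`limsup_tsum_sub_tsum_le`).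
-/

/-! ### Expectations along trajectories -/

section Trajectory

variable {A₁ : Type u} {A₂ : Type v} [Fintype A₁] [Fintype A₂] {fb : Feedback}
  {𝒢 : Set (BimatrixGame A₁ A₂)}

instance (π₁ : Algorithm₁ fb 𝒢) (s : 𝒢) (t : ℕ) : IsMarkovKernel (π₁.next s t) := π₁.isMarkov s t

instance (π₂ : Algorithm₂ fb 𝒢) (s : 𝒢) (t : ℕ) : IsMarkovKernel (π₂.next s t) := π₂.isMarkov s t

instance (q : ℕ → PMF 𝒢) (π₁ : Algorithm₁ fb 𝒢) (π₂ : Algorithm₂ fb 𝒢) (G : BimatrixGame A₁ A₂)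
    (s₁ s₂ : 𝒢) (t : ℕ) : IsMarkovKernel (roundKernel q π₁ π₂ G s₁ s₂ t) := by
  unfold roundKernel
  infer_instance

lemma measurable_snoc_history {X : Type*} [MeasurableSpace X] (t : ℕ) :
    Measurable fun z : (Fin t → X) × X =>
      (Fin.snoc (α := fun _ => X) z.1 z.2 : Fin (t + 1) → X) := by
  refine measurable_pi_lambda _ fun r => ?_
  induction r using Fin.lastCases with
  | last => simpa using measurable_snd
  | cast r =>
    simp only [Fin.snoc_castSucc]
    exact (measurable_pi_apply r).comp measurable_fst

instance (q : ℕ → PMF 𝒢) (π₁ : Algorithm₁ fb 𝒢) (π₂ : Algorithm₂ fb 𝒢) (G : BimatrixGame A₁ A₂)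
    (s₁ s₂ : 𝒢) (T : ℕ) : IsProbabilityMeasure (trajectory q π₁ π₂ G s₁ s₂ T) := by
  induction T with
  | zero => unfold trajectory; infer_instance
  | succ T ih =>
    unfold trajectory
    exact Measure.isProbabilityMeasure_map (measurable_snoc_history T).aemeasurable

lemma integrable_of_measurable_of_abs_le {X : Type*} [MeasurableSpace X] {μ : Measure X}
    [IsFiniteMeasure μ] {f : X → ℝ} (hf : Measurable f) {C : ℝ} (hC : ∀ x, |f x| ≤ C) :
    Integrable f μ :=
  Integrable.of_bound hf.aestronglyMeasurable C (.of_forall hC)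

lemma integral_le_of_forall_le {X : Type*} [MeasurableSpace X] {μ : Measure X}
    [IsProbabilityMeasure μ] {f : X → ℝ} (hf : Integrable f μ) {c : ℝ} (hc : ∀ x, f x ≤ c) :
    ∫ x, f x ∂μ ≤ c := by
  simpa using integral_mono hf (integrable_const c) hc

/-- The expected value at time `T` of a functional `V` of the history is at most its initial value
plus the sum of the bounds `c t` on its conditional expected increments. -/
lemma integral_trajectory_le (q : ℕ → PMF 𝒢) (π₁ : Algorithm₁ fb 𝒢) (π₂ : Algorithm₂ fb 𝒢)
    (G : BimatrixGame A₁ A₂) (s₁ s₂ : 𝒢)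
    (V : (t : ℕ) → (Fin t → MixedStrategy A₁ × MixedStrategy A₂) → ℝ) (c : ℕ → ℝ)
    (hV : ∀ t, Measurable (V t)) (hVb : ∀ t, ∃ C, ∀ h, |V t h| ≤ C)
    (hstep : ∀ t h, ∫ z, V (t + 1)
        (Fin.snoc (α := fun _ => MixedStrategy A₁ × MixedStrategy A₂) h z)
        ∂(roundKernel q π₁ π₂ G s₁ s₂ t h) ≤ V t h + c t) (T : ℕ) :
    ∫ h, V T h ∂(trajectory q π₁ π₂ G s₁ s₂ T) ≤ V 0 Fin.elim0 + ∑ t ∈ Finset.range T, c t := by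
  induction T with
  | zero =>
    simp only [trajectory, Finset.range_zero, Finset.sum_empty, add_zero]
    rw [integral_dirac' _ _ (hV 0).stronglyMeasurable]
  | succ T ih =>
    obtain ⟨C, hC⟩ := hVb (T + 1)
    have hm := (hV (T + 1)).comp
      (measurable_snoc_history (X := MixedStrategy A₁ × MixedStrategy A₂) T)
    have hint : Integrable (fun z : (Fin T → MixedStrategy A₁ × MixedStrategy A₂) × _ => V (T + 1)
        (Fin.snoc (α := fun _ => MixedStrategy A₁ × MixedStrategy A₂) z.1 z.2))
        (trajectory q π₁ π₂ G s₁ s₂ T ⊗ₘ roundKernel q π₁ π₂ G s₁ s₂ T) :=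
      integrable_of_measurable_of_abs_le hm fun _ => hC _
    obtain ⟨C', hC'⟩ := hVb T
    have hV' : Integrable (V T) (trajectory q π₁ π₂ G s₁ s₂ T) :=
      integrable_of_measurable_of_abs_le (hV T) hC'
    rw [trajectory, integral_map (measurable_snoc_history T).aemeasurable
      (hV _).aestronglyMeasurable, Measure.integral_compProd hint, Finset.sum_range_succ,
      ← add_assoc]
    calc _ ≤ ∫ h, (V T h + c T) ∂(trajectory q π₁ π₂ G s₁ s₂ T) :=
          integral_mono hint.integral_compProd (hV'.add (integrable_const _)) (hstep T)
      _ = ∫ h, V T h ∂(trajectory q π₁ π₂ G s₁ s₂ T) + c T := by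
          rw [integral_add hV' (integrable_const _)]; simp
      _ ≤ _ := by gcongr

/-- A bound on the conditional expectation over the first player's draw, for each strategy of the
second player, is a bound for the round, because the draws are independent. -/
lemma integral_roundKernel_le_of_left (q : ℕ → PMF 𝒢) (π₁ : Algorithm₁ fb 𝒢) (π₂ : Algorithm₂ fb 𝒢)
    (G : BimatrixGame A₁ A₂) (s₁ s₂ : 𝒢) (t : ℕ) (h : Fin t → MixedStrategy A₁ × MixedStrategy A₂)
    {f : MixedStrategy A₁ × MixedStrategy A₂ → ℝ} (hf : Measurable f) {C : ℝ}
    (hC : ∀ z, |f z| ≤ C) {c : ℝ}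
    (hc : ∀ y, ∫ x, f (x, y) ∂(π₁.next s₁ t (observations₁ fb G h)) ≤ c) :
    ∫ z, f z ∂(roundKernel q π₁ π₂ G s₁ s₂ t h) ≤ c := by
  have hi := integrable_of_measurable_of_abs_le (μ := roundKernel q π₁ π₂ G s₁ s₂ t h) hf hC
  rw [roundKernel, Kernel.prod_apply, Kernel.comap_apply] at hi ⊢
  rw [integral_prod_symm _ hi]
  exact integral_le_of_forall_le hi.integral_prod_right hc

lemma integral_roundKernel_le_of_right (q : ℕ → PMF 𝒢) (π₁ : Algorithm₁ fb 𝒢)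
    (π₂ : Algorithm₂ fb 𝒢)
    (G : BimatrixGame A₁ A₂) (s₁ s₂ : 𝒢) (t : ℕ) (h : Fin t → MixedStrategy A₁ × MixedStrategy A₂)
    {f : MixedStrategy A₁ × MixedStrategy A₂ → ℝ} (hf : Measurable f) {C : ℝ}
    (hC : ∀ z, |f z| ≤ C) {c : ℝ}
    (hc : ∀ x, ∫ y, f (x, y) ∂((π₂.next s₂ t ∘ₖ
      (Kernel.deterministic (observations₂ fb G) (measurable_observations₂ fb G) ×ₖ
        Kernel.const _ (q t).toMeasure)) h) ≤ c) :
    ∫ z, f z ∂(roundKernel q π₁ π₂ G s₁ s₂ t h) ≤ c := by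
  have hi := integrable_of_measurable_of_abs_le (μ := roundKernel q π₁ π₂ G s₁ s₂ t h) hf hC
  rw [roundKernel, Kernel.prod_apply] at hi ⊢
  rw [integral_prod _ hi]
  exact integral_le_of_forall_le hi.integral_prod_left hc

lemma tsum_signalProb {A₁ : Type u} {A₂ : Type v} {𝒢 : Set (BimatrixGame A₁ A₂)} (D : PMF 𝒢)
    (p : unitInterval) (G : 𝒢) :
    ∑' s, signalProb D p G s = 1 := by
  unfold signalProb
  rw [ENNReal.tsum_add, ENNReal.tsum_mul_left, ENNReal.tsum_mul_left, PMF.tsum_coe, PMF.tsum_coe,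
    mul_one, mul_one, ← ENNReal.ofReal_add p.2.1 (by linarith [p.2.2])]
  simp

instance (R : RepeatedBayesianGame A₁ A₂) (T : ℕ) (π₁ : Algorithm₁ fb R.family)
    (π₂ : Algorithm₂ fb R.family) (G : R.family) :
    IsProbabilityMeasure (R.mixedTrajectory T π₁ π₂ G) := by
  constructor
  unfold RepeatedBayesianGame.mixedTrajectory
  rw [Measure.sum_apply _ MeasurableSet.univ]
  simp only [Measure.smul_apply, measure_univ, smul_eq_mul, mul_one]
  rw [ENNReal.tsum_prod
    (f := fun s₁ s₂ => signalProb R.prior R.p₁ G s₁ * signalProb R.prior R.p₂ G s₂)]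
  simp only [ENNReal.tsum_mul_left, tsum_signalProb, mul_one]

lemma integral_mixedTrajectory_le (R : RepeatedBayesianGame A₁ A₂) {T : ℕ}
    {π₁ : Algorithm₁ fb R.family} {π₂ : Algorithm₂ fb R.family} {G : R.family}
    {f : (Fin T → MixedStrategy A₁ × MixedStrategy A₂) → ℝ} (hf : Measurable f) {C : ℝ}
    (hC : ∀ h, |f h| ≤ C) {c : ℝ}
    (hc : ∀ s₁ s₂, ∫ h, f h ∂(trajectory (R.external G) π₁ π₂ G.1 s₁ s₂ T) ≤ c) :
    ∫ h, f h ∂(R.mixedTrajectory T π₁ π₂ G) ≤ c := by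
  have hi := integrable_of_measurable_of_abs_le (μ := R.mixedTrajectory T π₁ π₂ G) hf hC
  have hi' : Integrable (fun h => f h - c) (R.mixedTrajectory T π₁ π₂ G) :=
    hi.sub (integrable_const c)
  have h1 : ∫ h, (f h - c) ∂(R.mixedTrajectory T π₁ π₂ G) ≤ 0 := by
    refine (hasSum_integral_measure hi').nonpos fun s => ?_
    rw [integral_smul_measure, integral_sub
      (integrable_of_measurable_of_abs_le hf hC) (integrable_const c)]
    simp only [integral_const, probReal_univ, smul_eq_mul]
    exact mul_nonpos_of_nonneg_of_nonpos ENNReal.toReal_nonneg (by linarith [hc s.1 s.2])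
  rw [integral_sub hi (integrable_const c)] at h1
  simpa using h1

end Trajectory

/-! ### Regret matching and approximately invariant distributions -/

section RegretMatching

variable {A : Type u} [Fintype A]

/-- The total positive regret, plus one so as to be usable as a normalizer. -/
noncomputable def regretMass (M : A → A → ℝ) : ℝ := 1 + ∑ a, ∑ a', max (M a a') 0

/-- The net flow of probability into `a'` when, from the distribution `v`, mass moves from each
action to each other action at a rate given by the positive part of the regret. -/
noncomputable def regretFlow (M : A → A → ℝ) (v : A → ℝ) (a' : A) : ℝ :=
  ∑ a, v a * max (M a a') 0 - v a' * ∑ a, max (M a' a) 0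

/-- One step of the Markov chain whose transition rates are the positive regrets, normalized so as
to be probabilities. -/
noncomputable def regretChain (M : A → A → ℝ) (v : A → ℝ) (a : A) : ℝ :=
  v a + regretFlow M v a / regretMass M

/-- An approximately invariant distribution of the chain of positive regrets: the average of its
first `n` steps from the uniform distribution. Unlike a choice of an exactly invariant distribution
it is visibly measurable in `M`; with `n` at least the normalizer, the net flow at each action is at
most one. -/
noncomputable def invariantMean (n : ℕ) (M : A → A → ℝ) (a : A) : ℝ :=
  (n : ℝ)⁻¹ * ∑ k ∈ Finset.range n, (regretChain M)^[k] (fun _ => (Fintype.card A : ℝ)⁻¹) a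

/-- The distribution that regret matching plays, before exploration. -/
noncomputable def regretMatching (M : A → A → ℝ) (a : A) : ℝ :=
  invariantMean ⌈regretMass M⌉₊ M a

lemma one_le_regretMass (M : A → A → ℝ) : 1 ≤ regretMass M := by
  have : 0 ≤ ∑ a, ∑ a', max (M a a') 0 :=
    Finset.sum_nonneg fun _ _ => Finset.sum_nonneg fun _ _ => le_max_right _ _
  unfold regretMass
  linarith

lemma regretChain_mem_stdSimplex (M : A → A → ℝ) {v : A → ℝ} (hv : v ∈ stdSimplex ℝ A) :
    regretChain M v ∈ stdSimplex ℝ A := by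
  have hL := one_le_regretMass M
  have hL0 : 0 < regretMass M := by linarith
  constructor
  · intro a'
    have h1 : ∑ a, max (M a' a) 0 ≤ regretMass M := by
      have : ∑ a, max (M a' a) 0 ≤ ∑ a, ∑ a', max (M a a') 0 :=
        Finset.single_le_sum (f := fun a => ∑ a', max (M a a') 0)
          (fun _ _ => Finset.sum_nonneg fun _ _ => le_max_right _ _) (Finset.mem_univ a')
      unfold regretMass
      linarith
    have h2 : 0 ≤ ∑ a, v a * max (M a a') 0 :=
      Finset.sum_nonneg fun a _ => mul_nonneg (hv.1 a) (le_max_right _ _)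
    have h3 : v a' * ∑ a, max (M a' a) 0 ≤ v a' * regretMass M :=
      mul_le_mul_of_nonneg_left h1 (hv.1 a')
    have h4 : regretChain M v a' = (v a' * regretMass M + regretFlow M v a') / regretMass M := by
      unfold regretChain
      field_simp
    rw [h4]
    refine div_nonneg ?_ hL0.le
    unfold regretFlow
    linarith
  · have h : ∑ a', regretFlow M v a' = 0 := by
      simp only [regretFlow, Finset.sum_sub_distrib, Finset.mul_sum]
      rw [Finset.sum_comm, sub_self]
    simp only [regretChain, Finset.sum_add_distrib, ← Finset.sum_div, h, hv.2, zero_div, add_zero]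

lemma uniform_mem_stdSimplex [Nonempty A] :
    (fun _ => (Fintype.card A : ℝ)⁻¹) ∈ stdSimplex ℝ A := by
  refine ⟨fun _ => by positivity, ?_⟩
  simp

lemma regretChain_iterate_mem_stdSimplex [Nonempty A] (M : A → A → ℝ) (k : ℕ) :
    (regretChain M)^[k] (fun _ => (Fintype.card A : ℝ)⁻¹) ∈ stdSimplex ℝ A := by
  induction k with
  | zero => exact uniform_mem_stdSimplex
  | succ k ih =>
    rw [Function.iterate_succ_apply']
    exact regretChain_mem_stdSimplex M ih

lemma regretMatching_mem_stdSimplex [Nonempty A] (M : A → A → ℝ) :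
    regretMatching M ∈ stdSimplex ℝ A := by
  have hn : (0 : ℝ) < ⌈regretMass M⌉₊ :=
    (zero_lt_one.trans_le (one_le_regretMass M)).trans_le (Nat.le_ceil _)
  refine ⟨fun a => mul_nonneg (by positivity) (Finset.sum_nonneg fun k _ =>
    (regretChain_iterate_mem_stdSimplex M k).1 a), ?_⟩
  simp only [regretMatching, invariantMean, ← Finset.mul_sum]
  rw [Finset.sum_comm]
  simp only [(regretChain_iterate_mem_stdSimplex M _).2, Finset.sum_const, Finset.card_range,
    nsmul_eq_mul, mul_one]
  exact inv_mul_cancel₀ hn.ne'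

/-- The flow at the averaged distribution telescopes. -/
lemma abs_regretFlow_regretMatching_le [Nonempty A] (M : A → A → ℝ) (a : A) :
    |regretFlow M (regretMatching M) a| ≤ 1 := by
  set n := ⌈regretMass M⌉₊ with hn
  have hL : (0 : ℝ) < regretMass M := zero_lt_one.trans_le (one_le_regretMass M)
  have hLn : regretMass M ≤ n := Nat.le_ceil _
  have hn0 : (0 : ℝ) < n := hL.trans_le hLn
  set w : ℕ → A → ℝ := fun k => (regretChain M)^[k] (fun _ => (Fintype.card A : ℝ)⁻¹) with hw
  have hwS : ∀ k, w k ∈ stdSimplex ℝ A := regretChain_iterate_mem_stdSimplex M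
  have hstep : ∀ k, regretFlow M (w k) a = regretMass M * (w (k + 1) a - w k a) := by
    intro k
    have : w (k + 1) = regretChain M (w k) := Function.iterate_succ_apply' _ _ _
    rw [this, regretChain]
    field_simp
    ring
  have hlin : regretFlow M (regretMatching M) a
      = (n : ℝ)⁻¹ * ∑ k ∈ Finset.range n, regretFlow M (w k) a := by
    simp only [regretFlow, regretMatching, invariantMean, ← hn, Finset.sum_sub_distrib, mul_sub]
    congr 1
    · rw [Finset.sum_comm, Finset.mul_sum]
      refine Finset.sum_congr rfl fun b _ => ?_
      rw [← Finset.sum_mul]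
      ring
    · rw [← Finset.sum_mul]
      ring
  rw [hlin, Finset.sum_congr rfl fun k _ => hstep k, ← Finset.mul_sum,
    Finset.sum_range_sub (fun k => w k a), abs_mul, abs_mul, abs_of_pos hL,
    abs_of_pos (inv_pos.2 hn0)]
  have h1 := mem_Icc_of_mem_stdSimplex (hwS n) a
  have h2 := mem_Icc_of_mem_stdSimplex (hwS 0) a
  have h3 : |w n a - w 0 a| ≤ 1 := abs_le.2 ⟨by linarith [h1.1, h2.2], by linarith [h1.2, h2.1]⟩
  calc (n : ℝ)⁻¹ * (regretMass M * |w n a - w 0 a|) ≤ (n : ℝ)⁻¹ * (n * 1) := by gcongr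
    _ = 1 := by rw [mul_one]; exact inv_mul_cancel₀ hn0.ne'

lemma measurable_regretMass : Measurable (regretMass : (A → A → ℝ) → ℝ) := by
  unfold regretMass
  fun_prop

lemma measurable_regretChain_iterate (k : ℕ) (a : A) :
    Measurable fun M : A → A → ℝ => (regretChain M)^[k] (fun _ => (Fintype.card A : ℝ)⁻¹) a := by
  induction k generalizing a with
  | zero => exact measurable_const
  | succ k ih =>
    simp only [Function.iterate_succ_apply', regretChain, regretFlow]
    have := measurable_regretMass (A := A)
    fun_prop

lemma measurable_regretMatching (a : A) :
    Measurable fun M : A → A → ℝ => regretMatching M a := by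
  have h : Measurable fun z : ℕ × (A → A → ℝ) => invariantMean z.1 z.2 a := by
    refine measurable_from_prod_countable_right fun n => ?_
    simp only [invariantMean]
    exact (Finset.measurable_sum _ fun k _ => measurable_regretChain_iterate k a).const_mul _
  exact h.comp ((Nat.measurable_ceil.comp measurable_regretMass).prodMk measurable_id)

end RegretMatching

/-! ### Regret matching with bandit feedback -/

section Bandit

variable {A : Type u} [Fintype A]

open scoped Classical in
/-- An action as a mixed strategy. -/
noncomputable def pureStrategy (a : A) : MixedStrategy A :=
  ⟨Pi.single a 1, single_mem_stdSimplex ℝ a⟩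

/-- The law of the pure strategy that is drawn from the distribution `p`. -/
noncomputable def drawPure (p : A → ℝ) : Measure (MixedStrategy A) :=
  ∑ a, ENNReal.ofReal (p a) • Measure.dirac (pureStrategy a)

lemma isProbabilityMeasure_drawPure {p : A → ℝ} (hp : p ∈ stdSimplex ℝ A) :
    IsProbabilityMeasure (drawPure p) := by
  constructor
  simp only [drawPure, Measure.coe_finsetSum, Finset.sum_apply, Measure.smul_apply, measure_univ,
    smul_eq_mul, mul_one]
  rw [← ENNReal.ofReal_sum_of_nonneg fun a _ => hp.1 a, hp.2, ENNReal.ofReal_one]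

lemma integral_drawPure {p : A → ℝ} (hp : p ∈ stdSimplex ℝ A) (f : MixedStrategy A → ℝ) :
    ∫ x, f x ∂(drawPure p) = ∑ a, p a * f (pureStrategy a) := by
  rw [drawPure, integral_finsetSum_measure]
  · refine Finset.sum_congr rfl fun a _ => ?_
    rw [integral_smul_measure, integral_dirac, ENNReal.toReal_ofReal (hp.1 a), smul_eq_mul]
  · exact fun a _ => (integrable_dirac (by simp)).smul_measure ENNReal.ofReal_ne_top

lemma measurable_drawPure {X : Type*} [MeasurableSpace X] {p : X → A → ℝ} (hp : Measurable p) :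
    Measurable fun x => drawPure (p x) := by
  refine Measure.measurable_of_measurable_coe _ fun s _ => ?_
  simp only [drawPure, Measure.coe_finsetSum, Finset.sum_apply, Measure.smul_apply, smul_eq_mul]
  exact Finset.measurable_sum _ fun a _ =>
    (ENNReal.measurable_ofReal.comp ((measurable_pi_apply a).comp hp)).mul_const _

/-- The exploration rate `(t + 1)^(-1/4)`. It vanishes, so that exploring is free in the long run,
but slowly enough for the second moments of the utility estimates to stay `o(t)`. -/
noncomputable def explorationRate (t : ℕ) : ℝ := (√(√(t + 1)))⁻¹

/-- The distribution of the action of round `t`: regret matching mixed with uniform exploration. -/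
noncomputable def playProb (t : ℕ) (M : A → A → ℝ) (a : A) : ℝ :=
  (1 - explorationRate t) * regretMatching M a + explorationRate t / Fintype.card A

/-- The importance-weighted estimate of the utilities of all actions after playing the pure strategy
`x` and receiving the utility `w`. -/
noncomputable def utilityEstimate (t : ℕ) (M : A → A → ℝ) (x : MixedStrategy A) (w : ℝ) (a : A) :
    ℝ :=
  x.1 a * w / playProb t M a

/-- The estimated gain in a round of having played `a'` whenever regret matching prescribed `a`. -/
noncomputable def regretIncrement (t : ℕ) (M : A → A → ℝ) (x : MixedStrategy A) (w : ℝ) (a a' : A) :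
    ℝ :=
  regretMatching M a * (utilityEstimate t M x w a' - utilityEstimate t M x w a)

/-- The estimated cumulative internal regrets after the rounds with the given own strategies and
utilities. -/
noncomputable def regretState : (t : ℕ) → (Fin t → MixedStrategy A × ℝ) → A → A → ℝ
  | 0, _ => 0
  | t + 1, o =>
    regretState t (fun r => o r.castSucc) +
      regretIncrement t (regretState t fun r => o r.castSucc) (o (Fin.last t)).1 (o (Fin.last t)).2

/-- The potential of Blackwell approachability: the squared distance of the regrets from the
nonpositive orthant. -/
noncomputable def regretPotential (M : A → A → ℝ) : ℝ := ∑ a, ∑ a', (max (M a a') 0) ^ 2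

lemma explorationRate_pos (t : ℕ) : 0 < explorationRate t := by
  unfold explorationRate
  positivity

lemma explorationRate_le_one (t : ℕ) : explorationRate t ≤ 1 := by
  unfold explorationRate
  refine inv_le_one_of_one_le₀ ?_
  rw [Real.one_le_sqrt, Real.one_le_sqrt]
  linarith [Nat.cast_nonneg (α := ℝ) t]

lemma tendsto_explorationRate : Tendsto explorationRate atTop (𝓝 0) := by
  unfold explorationRate
  refine tendsto_inv_atTop_zero.comp
    (Real.tendsto_sqrt_atTop.comp (Real.tendsto_sqrt_atTop.comp ?_))
  exact tendsto_atTop_add_const_right _ _ tendsto_natCast_atTop_atTop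

variable [Nonempty A]

lemma playProb_mem_stdSimplex (t : ℕ) (M : A → A → ℝ) : playProb t M ∈ stdSimplex ℝ A := by
  have h1 := explorationRate_pos t
  have h2 := explorationRate_le_one t
  have h := regretMatching_mem_stdSimplex M
  refine ⟨fun a => ?_, ?_⟩
  · have := h.1 a
    have h3 : 0 ≤ 1 - explorationRate t := by linarith
    unfold playProb
    positivity
  · simp only [playProb, Finset.sum_add_distrib, ← Finset.mul_sum, h.2, Finset.sum_const,
      Finset.card_univ, nsmul_eq_mul]
    field_simp
    ring

lemma le_playProb (t : ℕ) (M : A → A → ℝ) (a : A) :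
    explorationRate t / Fintype.card A ≤ playProb t M a := by
  have h2 := explorationRate_le_one t
  have := mul_nonneg (sub_nonneg.2 h2) ((regretMatching_mem_stdSimplex M).1 a)
  unfold playProb
  linarith

lemma playProb_pos (t : ℕ) (M : A → A → ℝ) (a : A) : 0 < playProb t M a :=
  (div_pos (explorationRate_pos t) (by positivity)).trans_le (le_playProb t M a)

lemma abs_playProb_sub_regretMatching_le (t : ℕ) (M : A → A → ℝ) (a : A) :
    |playProb t M a - regretMatching M a| ≤ explorationRate t := by
  have h0 := explorationRate_pos t
  have h := mem_Icc_of_mem_stdSimplex (regretMatching_mem_stdSimplex M) a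
  have h' := mem_Icc_of_mem_stdSimplex (uniform_mem_stdSimplex (A := A)) a
  have he : playProb t M a - regretMatching M a
      = explorationRate t * ((Fintype.card A : ℝ)⁻¹ - regretMatching M a) := by
    unfold playProb
    ring
  rw [he, abs_mul, abs_of_pos h0]
  have : |(Fintype.card A : ℝ)⁻¹ - regretMatching M a| ≤ 1 :=
    abs_le.2 ⟨by linarith [h.2, h'.1], by linarith [h.1, h'.2]⟩
  exact mul_le_of_le_one_right h0.le this

lemma abs_utilityEstimate_le (t : ℕ) (M : A → A → ℝ) (x : MixedStrategy A) {w B : ℝ}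
    (hw : |w| ≤ B) (a : A) :
    |utilityEstimate t M x w a| ≤ B * Fintype.card A / explorationRate t := by
  have h0 := explorationRate_pos t
  have hp := playProb_pos t M a
  have hx := mem_Icc_of_mem_stdSimplex x.2 a
  have hB : 0 ≤ B := (abs_nonneg w).trans hw
  unfold utilityEstimate
  rw [abs_div, abs_of_pos hp, abs_mul, abs_of_nonneg hx.1]
  calc x.1 a * |w| / playProb t M a ≤ 1 * B / (explorationRate t / Fintype.card A) := by
        gcongr
        · exact hx.2
        · exact le_playProb t M a
    _ = _ := by field_simp

lemma abs_regretIncrement_le (t : ℕ) (M : A → A → ℝ) (x : MixedStrategy A) {w B : ℝ}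
    (hw : |w| ≤ B) (a a' : A) :
    |regretIncrement t M x w a a'| ≤ 2 * B * Fintype.card A / explorationRate t := by
  have h1 := abs_utilityEstimate_le t M x hw a
  have h2 := abs_utilityEstimate_le t M x hw a'
  have h := mem_Icc_of_mem_stdSimplex (regretMatching_mem_stdSimplex M) a
  unfold regretIncrement
  rw [abs_mul, abs_of_nonneg h.1]
  calc _ ≤ 1 * (|utilityEstimate t M x w a'| + |utilityEstimate t M x w a|) := by
        gcongr
        · exact h.2
        · exact abs_sub _ _
    _ ≤ B * Fintype.card A / explorationRate t + B * Fintype.card A / explorationRate t := by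
        linarith
    _ = _ := by ring

omit [Nonempty A] in
open scoped Classical in
lemma pureStrategy_apply (c a : A) : (pureStrategy c).1 a = if a = c then 1 else 0 := by
  simp [pureStrategy, Pi.single_apply]

/-- The utility estimates are unbiased. -/
lemma sum_playProb_mul_utilityEstimate (t : ℕ) (M : A → A → ℝ) (w : A → ℝ) (a : A) :
    ∑ c, playProb t M c * utilityEstimate t M (pureStrategy c) (w c) a = w a := by
  classical
  rw [Finset.sum_eq_single a]
  · rw [utilityEstimate, pureStrategy_apply, if_pos rfl]
    have := (playProb_pos t M a).ne'
    field_simp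
  · intro c _ hc
    rw [utilityEstimate, pureStrategy_apply, if_neg (Ne.symm hc)]
    simp
  · simp

lemma sum_playProb_mul_regretIncrement (t : ℕ) (M : A → A → ℝ) (w : A → ℝ) (a a' : A) :
    ∑ c, playProb t M c * regretIncrement t M (pureStrategy c) (w c) a a' =
      regretMatching M a * (w a' - w a) := by
  rw [← sum_playProb_mul_utilityEstimate t M w a', ← sum_playProb_mul_utilityEstimate t M w a,
    ← Finset.sum_sub_distrib, Finset.mul_sum]
  refine Finset.sum_congr rfl fun c _ => ?_
  unfold regretIncrement
  ring

lemma sq_max_add_le (x r : ℝ) : (max (x + r) 0) ^ 2 ≤ (max x 0) ^ 2 + 2 * max x 0 * r + r ^ 2 := by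
  rcases le_total 0 x with hx | hx <;> rcases le_total 0 (x + r) with hr | hr
  · rw [max_eq_left hx, max_eq_left hr]; nlinarith
  · rw [max_eq_left hx, max_eq_right hr]; nlinarith [sq_nonneg (x + r)]
  · rw [max_eq_right hx, max_eq_left hr]; nlinarith
  · rw [max_eq_right hx, max_eq_right hr]; nlinarith [sq_nonneg r]

/-- The first-order term of the potential: approximate invariance of the distribution played makes
it bounded, whatever the utilities are. -/
lemma sum_max_mul_regretMatching_le (M : A → A → ℝ) {w : A → ℝ} {B : ℝ} (hw : ∀ a, |w a| ≤ B) :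
    ∑ a, ∑ a', max (M a a') 0 * (regretMatching M a * (w a' - w a)) ≤ Fintype.card A * B := by
  have h : ∑ a, ∑ a', max (M a a') 0 * (regretMatching M a * (w a' - w a))
      = ∑ a, w a * regretFlow M (regretMatching M) a := by
    simp only [regretFlow, mul_sub, Finset.sum_sub_distrib]
    congr 1
    · rw [Finset.sum_comm]
      refine Finset.sum_congr rfl fun a _ => ?_
      rw [Finset.mul_sum]
      exact Finset.sum_congr rfl fun _ _ => by ring
    · refine Finset.sum_congr rfl fun a _ => ?_
      rw [Finset.mul_sum, Finset.mul_sum]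
      exact Finset.sum_congr rfl fun _ _ => by ring
  rw [h]
  calc _ ≤ ∑ _a : A, B := by
        refine Finset.sum_le_sum fun a _ => (le_abs_self _).trans ?_
        rw [abs_mul]
        exact (mul_le_of_le_one_right (abs_nonneg _) (abs_regretFlow_regretMatching_le M a)).trans
          (hw a)
    _ = _ := by simp

lemma sum_playProb_mul_regretPotential_le (t : ℕ) (M : A → A → ℝ) {w : A → ℝ} {B : ℝ}
    (hw : ∀ a, |w a| ≤ B) :
    ∑ c, playProb t M c * regretPotential (M + regretIncrement t M (pureStrategy c) (w c)) ≤
      regretPotential M + (2 * (Fintype.card A * B) +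
        Fintype.card A ^ 2 * (2 * B * Fintype.card A / explorationRate t) ^ 2) := by
  have hp := playProb_mem_stdSimplex t M
  set K := 2 * B * Fintype.card A / explorationRate t with hK
  have h1 : ∀ c, regretPotential (M + regretIncrement t M (pureStrategy c) (w c)) ≤
      regretPotential M + 2 * (∑ a, ∑ a', max (M a a') 0 *
        regretIncrement t M (pureStrategy c) (w c) a a') + Fintype.card A ^ 2 * K ^ 2 := by
    intro c
    have hc : (Fintype.card A : ℝ) ^ 2 * K ^ 2 = ∑ _a : A, ∑ _a' : A, K ^ 2 := by
      simp; ring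
    rw [hc, regretPotential, regretPotential, Finset.mul_sum, ← Finset.sum_add_distrib,
      ← Finset.sum_add_distrib]
    refine Finset.sum_le_sum fun a _ => ?_
    rw [Finset.mul_sum, ← Finset.sum_add_distrib, ← Finset.sum_add_distrib]
    refine Finset.sum_le_sum fun a' _ => ?_
    have h2 := sq_max_add_le (M a a') (regretIncrement t M (pureStrategy c) (w c) a a')
    have hr := abs_regretIncrement_le t M (pureStrategy c) (hw c) a a'
    have h3 := sq_le_sq' (neg_le_of_abs_le hr) (le_of_abs_le hr)
    rw [← hK] at h3
    simp only [Pi.add_apply]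
    linarith
  calc _ ≤ ∑ c, playProb t M c * (regretPotential M + 2 * (∑ a, ∑ a', max (M a a') 0 *
        regretIncrement t M (pureStrategy c) (w c) a a') + Fintype.card A ^ 2 * K ^ 2) :=
        Finset.sum_le_sum fun c _ => mul_le_mul_of_nonneg_left (h1 c) (hp.1 c)
    _ = regretPotential M + 2 * (∑ a, ∑ a', max (M a a') 0 *
        (∑ c, playProb t M c * regretIncrement t M (pureStrategy c) (w c) a a'))
        + Fintype.card A ^ 2 * K ^ 2 := by
        simp only [mul_add, Finset.sum_add_distrib, ← Finset.sum_mul, hp.2, one_mul]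
        congr 2
        simp only [Finset.mul_sum]
        rw [Finset.sum_comm]
        refine Finset.sum_congr rfl fun a _ => ?_
        rw [Finset.sum_comm]
        refine Finset.sum_congr rfl fun a' _ => Finset.sum_congr rfl fun c _ => ?_
        ring
    _ ≤ _ := by
        simp only [sum_playProb_mul_regretIncrement]
        linarith [sum_max_mul_regretMatching_le M hw]

/-- The estimated regret of regret matching accounts for the regret of the play up to the cost of
exploration. -/
lemma sum_playProb_mul_sub_regretIncrement_le (t : ℕ) (M : A → A → ℝ) {w : A → ℝ} {B : ℝ}
    (hw : ∀ a, |w a| ≤ B) (a a' : A) :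
    ∑ c, playProb t M c * ((pureStrategy c).1 a * (w a' - w a) -
      regretIncrement t M (pureStrategy c) (w c) a a') ≤ 2 * B * explorationRate t := by
  classical
  have h1 : ∑ c, playProb t M c * ((pureStrategy c).1 a * (w a' - w a) -
      regretIncrement t M (pureStrategy c) (w c) a a') =
      (playProb t M a - regretMatching M a) * (w a' - w a) := by
    simp only [mul_sub (playProb t M _), Finset.sum_sub_distrib, sum_playProb_mul_regretIncrement]
    simp [pureStrategy_apply, sub_mul]
  rw [h1]
  refine (le_abs_self _).trans ?_
  rw [abs_mul]
  have h2 : |w a' - w a| ≤ 2 * B := (abs_sub _ _).trans (by linarith [hw a, hw a'])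
  calc _ ≤ explorationRate t * (2 * B) :=
        mul_le_mul (abs_playProb_sub_regretMatching_le t M a) h2 (abs_nonneg _)
          (explorationRate_pos t).le
    _ = _ := by ring

omit [Nonempty A] in
lemma measurable_playProb {X : Type*} [MeasurableSpace X] (t : ℕ) {M : X → A → A → ℝ}
    (hM : Measurable M) (a : A) : Measurable fun x => playProb t (M x) a :=
  (((measurable_regretMatching a).comp hM).const_mul _).add_const _

omit [Nonempty A] in
lemma measurable_regretState (t : ℕ) :
    Measurable (regretState t : (Fin t → MixedStrategy A × ℝ) → A → A → ℝ) := by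
  induction t with
  | zero => exact measurable_const
  | succ t ih =>
    have h1 : Measurable fun o : Fin (t + 1) → MixedStrategy A × ℝ =>
        regretState t fun r => o r.castSucc :=
      ih.comp (measurable_pi_lambda _ fun r => measurable_pi_apply _)
    have hl : Measurable fun o : Fin (t + 1) → MixedStrategy A × ℝ => o (Fin.last t) :=
      measurable_pi_apply _
    have he : ∀ a, Measurable fun o : Fin (t + 1) → MixedStrategy A × ℝ =>
        utilityEstimate t (regretState t fun r => o r.castSucc) (o (Fin.last t)).1
          (o (Fin.last t)).2 a := fun a =>
      ((((measurable_pi_apply a).comp measurable_subtype_coe).comp hl.fst).mul hl.snd).div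
        (measurable_playProb t h1 a)
    refine measurable_pi_lambda _ fun a => measurable_pi_lambda _ fun a' => ?_
    exact ((measurable_pi_apply a').comp ((measurable_pi_apply a).comp h1)).add
      (((measurable_regretMatching a).comp h1).mul ((he a').sub (he a)))

lemma exists_abs_regretState_le {B : ℝ} (t : ℕ) :
    ∃ C, ∀ o : Fin t → MixedStrategy A × ℝ, (∀ r, |(o r).2| ≤ B) →
      ∀ a a', |regretState t o a a'| ≤ C := by
  induction t with
  | zero => exact ⟨0, fun o _ a a' => by simp [regretState]⟩
  | succ t ih =>
    obtain ⟨C, hC⟩ := ih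
    refine ⟨C + 2 * B * Fintype.card A / explorationRate t, fun o ho a a' => ?_⟩
    exact (abs_add_le _ _).trans (add_le_add (hC _ (fun r => ho _) a a')
      (abs_regretIncrement_le t _ _ (ho _) a a'))

end Bandit

/-! ### Utility functions and their bounds -/

section Utilities

variable {A₁ : Type u} {A₂ : Type v} [Fintype A₁] [Fintype A₂]

/-- The utility of an action of the first player against a mixed strategy of the second player. -/
noncomputable def actionUtility (w : A₁ → A₂ → ℝ) (a : A₁) (y : MixedStrategy A₂) : ℝ :=
  ∑ b, y.1 b * w a b

/-- A bound for the absolute value of a utility function. -/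
noncomputable def utilityBound (w : A₁ → A₂ → ℝ) : ℝ := ∑ a, ∑ b, |w a b|

lemma utilityBound_nonneg (w : A₁ → A₂ → ℝ) : 0 ≤ utilityBound w :=
  Finset.sum_nonneg fun _ _ => Finset.sum_nonneg fun _ _ => abs_nonneg _

lemma abs_le_utilityBound (w : A₁ → A₂ → ℝ) (a : A₁) (b : A₂) : |w a b| ≤ utilityBound w :=
  (Finset.single_le_sum (f := fun b => |w a b|) (fun _ _ => abs_nonneg _) (Finset.mem_univ b)).trans
    (Finset.single_le_sum (f := fun a => ∑ b, |w a b|)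
      (fun _ _ => Finset.sum_nonneg fun _ _ => abs_nonneg _) (Finset.mem_univ a))

lemma mixedUtility_eq (w : A₁ → A₂ → ℝ) (x : MixedStrategy A₁) (y : MixedStrategy A₂) :
    mixedUtility w x y = ∑ a, x.1 a * actionUtility w a y := by
  simp only [mixedUtility, actionUtility, Finset.mul_sum, mul_assoc]

lemma abs_sum_stdSimplex_mul_le {A : Type*} [Fintype A] (x : MixedStrategy A) {f : A → ℝ} {B : ℝ}
    (hf : ∀ a, |f a| ≤ B) : |∑ a, x.1 a * f a| ≤ B :=
  calc |∑ a, x.1 a * f a| ≤ ∑ a, x.1 a * B := by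
        refine (Finset.abs_sum_le_sum_abs _ _).trans (Finset.sum_le_sum fun a _ => ?_)
        rw [abs_mul, abs_of_nonneg (x.2.1 a)]
        exact mul_le_mul_of_nonneg_left (hf a) (x.2.1 a)
    _ = B := by rw [← Finset.sum_mul, x.2.2, one_mul]

lemma abs_actionUtility_le (w : A₁ → A₂ → ℝ) (a : A₁) (y : MixedStrategy A₂) :
    |actionUtility w a y| ≤ utilityBound w :=
  abs_sum_stdSimplex_mul_le y fun b => abs_le_utilityBound w a b

lemma abs_mixedUtility_le (w : A₁ → A₂ → ℝ) (x : MixedStrategy A₁) (y : MixedStrategy A₂) :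
    |mixedUtility w x y| ≤ utilityBound w := by
  rw [mixedUtility_eq]
  exact abs_sum_stdSimplex_mul_le x fun a => abs_actionUtility_le w a y

lemma mixedUtility_pureStrategy (w : A₁ → A₂ → ℝ) (a : A₁) (y : MixedStrategy A₂) :
    mixedUtility w (pureStrategy a) y = actionUtility w a y := by
  classical
  rw [mixedUtility_eq]
  simp [pureStrategy_apply]

lemma measurable_stdSimplex_apply {A : Type*} [Fintype A] (a : A) :
    Measurable fun x : MixedStrategy A => x.1 a :=
  (measurable_pi_apply a).comp measurable_subtype_coe

omit [Fintype A₁] in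
lemma measurable_actionUtility (w : A₁ → A₂ → ℝ) (a : A₁) : Measurable (actionUtility w a) := by
  unfold actionUtility
  exact Finset.measurable_sum _ fun b _ => (measurable_stdSimplex_apply b).mul_const _

end Utilities

/-! ### The internal regret of the first player -/

section Algorithm

variable {A₁ : Type u} {A₂ : Type v} [Fintype A₁] [Fintype A₂] [Nonempty A₁]

/-- Regret matching with exploration as an algorithm of the first player. It uses only her own
strategies and utilities, neither her signal nor what she may see of the opponent. -/
noncomputable def regretMatchingAlgorithm (fb : Feedback) (𝒢 : Set (BimatrixGame A₁ A₂)) :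
    Algorithm₁ fb 𝒢 where
  next _ t :=
    { toFun := fun o => drawPure (playProb t (regretState t fun r => ((o r).1, (o r).2.2)))
      measurable' := by
        refine measurable_drawPure (measurable_pi_lambda _ fun a => measurable_playProb t
          ((measurable_regretState t).comp (measurable_pi_lambda _ fun r => ?_)) a)
        have hr : Measurable fun o : Fin t → Observation fb (MixedStrategy A₁) (MixedStrategy A₂) =>
          o r := measurable_pi_apply r
        exact hr.fst.prodMk hr.snd.snd }
  isMarkov _ t := ⟨fun _ => isProbabilityMeasure_drawPure (playProb_mem_stdSimplex t _)⟩

/-- The estimated internal regrets of the first player along a history of the game with utilities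
`w`. -/
noncomputable def historyRegret (w : A₁ → A₂ → ℝ) {t : ℕ}
    (h : Fin t → MixedStrategy A₁ × MixedStrategy A₂) : A₁ → A₁ → ℝ :=
  regretState t fun r => ((h r).1, mixedUtility w (h r).1 (h r).2)

omit [Nonempty A₁] in
lemma historyRegret_snoc (w : A₁ → A₂ → ℝ) {t : ℕ}
    (h : Fin t → MixedStrategy A₁ × MixedStrategy A₂) (z : MixedStrategy A₁ × MixedStrategy A₂) :
    historyRegret w (Fin.snoc (α := fun _ => MixedStrategy A₁ × MixedStrategy A₂) h z) =
      historyRegret w h +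
        regretIncrement t (historyRegret w h) z.1 (mixedUtility w z.1 z.2) := by
  unfold historyRegret
  rw [regretState]
  simp only [Fin.snoc_castSucc, Fin.snoc_last]

omit [Nonempty A₁] in
lemma measurable_historyRegret (w : A₁ → A₂ → ℝ) (t : ℕ) :
    Measurable (historyRegret w (t := t)) := by
  refine (measurable_regretState t).comp (measurable_pi_lambda _ fun r => ?_)
  have hr : Measurable fun h : Fin t → MixedStrategy A₁ × MixedStrategy A₂ => h r :=
    measurable_pi_apply r
  exact hr.fst.prodMk ((measurable_mixedUtility w).comp hr)

lemma exists_abs_historyRegret_le (w : A₁ → A₂ → ℝ) (t : ℕ) :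
    ∃ C, ∀ (h : Fin t → MixedStrategy A₁ × MixedStrategy A₂) a a',
      |historyRegret w h a a'| ≤ C := by
  obtain ⟨C, hC⟩ := exists_abs_regretState_le (A := A₁) (B := utilityBound w) t
  exact ⟨C, fun h => hC _ fun r => abs_mixedUtility_le _ _ _⟩

lemma integral_regretMatchingAlgorithm (fb : Feedback) (𝒢 : Set (BimatrixGame A₁ A₂))
    (G : BimatrixGame A₁ A₂) (s : 𝒢) (t : ℕ) (h : Fin t → MixedStrategy A₁ × MixedStrategy A₂)
    (f : MixedStrategy A₁ → ℝ) :
    ∫ x, f x ∂((regretMatchingAlgorithm fb 𝒢).next s t (observations₁ fb G h)) =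
      ∑ c, playProb t (historyRegret G.U₁ h) c * f (pureStrategy c) :=
  integral_drawPure (playProb_mem_stdSimplex t _) f

variable {fb : Feedback} {𝒢 : Set (BimatrixGame A₁ A₂)}

/-- The growth constant of the regret potential. -/
noncomputable def potentialConstant (w : A₁ → A₂ → ℝ) : ℝ :=
  1 + 2 * (Fintype.card A₁ * utilityBound w) +
    Fintype.card A₁ ^ 2 * (2 * utilityBound w * Fintype.card A₁) ^ 2

omit [Nonempty A₁] in
lemma one_le_potentialConstant (w : A₁ → A₂ → ℝ) : 1 ≤ potentialConstant w := by
  have := utilityBound_nonneg w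
  have h : 0 ≤ 2 * (Fintype.card A₁ * utilityBound w) +
    Fintype.card A₁ ^ 2 * (2 * utilityBound w * Fintype.card A₁) ^ 2 := by positivity
  unfold potentialConstant
  linarith

omit [Nonempty A₁] in
lemma regretPotential_nonneg (M : A₁ → A₁ → ℝ) : 0 ≤ regretPotential M :=
  Finset.sum_nonneg fun _ _ => Finset.sum_nonneg fun _ _ => sq_nonneg _

omit [Nonempty A₁] in
lemma measurable_regretPotential : Measurable (regretPotential : (A₁ → A₁ → ℝ) → ℝ) := by
  unfold regretPotential
  fun_prop

omit [Nonempty A₁] in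
lemma regretPotential_le {M : A₁ → A₁ → ℝ} {C : ℝ} (hM : ∀ a a', |M a a'| ≤ C) :
    regretPotential M ≤ ∑ _a : A₁, ∑ _a' : A₁, C ^ 2 := by
  refine Finset.sum_le_sum fun a _ => Finset.sum_le_sum fun a' _ => ?_
  have h := hM a a'
  have hC : 0 ≤ C := (abs_nonneg _).trans h
  have : max (M a a') 0 ≤ C := max_le (le_of_abs_le h) hC
  exact pow_le_pow_left₀ (le_max_right _ _) this 2

lemma exists_abs_regretPotential_le (w : A₁ → A₂ → ℝ) (t : ℕ) :
    ∃ C, ∀ h : Fin t → MixedStrategy A₁ × MixedStrategy A₂,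
      |regretPotential (historyRegret w h)| ≤ C := by
  obtain ⟨C, hC⟩ := exists_abs_historyRegret_le w t
  refine ⟨∑ _a : A₁, ∑ _a' : A₁, C ^ 2, fun h => ?_⟩
  rw [abs_of_nonneg (regretPotential_nonneg _)]
  exact regretPotential_le (hC h)

lemma integral_regretPotential_le (q : ℕ → PMF 𝒢) (π₂ : Algorithm₂ fb 𝒢)
    (G : BimatrixGame A₁ A₂) (s₁ s₂ : 𝒢) (T : ℕ) :
    ∫ h, regretPotential (historyRegret G.U₁ h)
      ∂(trajectory q (regretMatchingAlgorithm fb 𝒢) π₂ G s₁ s₂ T) ≤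
      T * (potentialConstant G.U₁ * √T) := by
  have key := integral_trajectory_le q (regretMatchingAlgorithm fb 𝒢) π₂ G s₁ s₂
    (fun t h => regretPotential (historyRegret G.U₁ h))
    (fun t => 2 * (Fintype.card A₁ * utilityBound G.U₁) + Fintype.card A₁ ^ 2 *
      (2 * utilityBound G.U₁ * Fintype.card A₁ / explorationRate t) ^ 2)
    (fun t => measurable_regretPotential.comp (measurable_historyRegret _ t))
    (exists_abs_regretPotential_le _) ?_ T
  · refine key.trans ?_
    have h0 : regretPotential (historyRegret G.U₁
        (Fin.elim0 : Fin 0 → MixedStrategy A₁ × MixedStrategy A₂)) = 0 := by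
      simp [historyRegret, regretState, regretPotential]
    rw [h0, zero_add]
    calc _ ≤ ∑ _t ∈ Finset.range T, potentialConstant G.U₁ * √T := ?_
      _ = _ := by simp
    refine Finset.sum_le_sum fun t ht => ?_
    have ht' : ((t : ℝ) + 1) ≤ T := by exact_mod_cast Finset.mem_range.1 ht
    have h1 : (1 : ℝ) ≤ √T := by
      rw [Real.one_le_sqrt]
      linarith [Nat.cast_nonneg (α := ℝ) t]
    have h2 : (explorationRate t)⁻¹ ^ 2 ≤ √T := by
      rw [explorationRate, inv_inv, Real.sq_sqrt (Real.sqrt_nonneg _)]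
      exact Real.sqrt_le_sqrt ht'
    have hB := utilityBound_nonneg G.U₁
    rw [div_eq_mul_inv, mul_pow _ (explorationRate t)⁻¹, ← mul_assoc ((Fintype.card A₁ : ℝ) ^ 2),
      potentialConstant, add_mul]
    refine add_le_add ?_ (mul_le_mul_of_nonneg_left h2
      (mul_nonneg (sq_nonneg _) (sq_nonneg _)))
    have : 0 ≤ 2 * (Fintype.card A₁ * utilityBound G.U₁) := by positivity
    nlinarith
  · intro t h
    obtain ⟨C, hC⟩ := exists_abs_regretPotential_le G.U₁ (t + 1)
    have hm : Measurable fun z => regretPotential (historyRegret G.U₁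
        (Fin.snoc (α := fun _ => MixedStrategy A₁ × MixedStrategy A₂) h z)) :=
      (measurable_regretPotential.comp (measurable_historyRegret _ _)).comp
        ((measurable_snoc_history t).comp measurable_prodMk_left)
    refine integral_roundKernel_le_of_left _ _ _ _ _ _ _ _ hm (fun z => hC _) fun y => ?_
    rw [integral_regretMatchingAlgorithm]
    simp only [historyRegret_snoc, mixedUtility_pureStrategy]
    exact sum_playProb_mul_regretPotential_le t _ fun a => abs_actionUtility_le _ _ _

/-- The gain of the first player in the rounds in which she plays `a` from playing `a'` instead. -/
noncomputable def swapGain (w : A₁ → A₂ → ℝ) (a a' : A₁)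
    (z : MixedStrategy A₁ × MixedStrategy A₂) : ℝ :=
  z.1.1 a * (actionUtility w a' z.2 - actionUtility w a z.2)

omit [Nonempty A₁] in
lemma measurable_swapGain (w : A₁ → A₂ → ℝ) (a a' : A₁) : Measurable (swapGain w a a') :=
  ((measurable_stdSimplex_apply a).comp measurable_fst).mul
    (((measurable_actionUtility w a').comp measurable_snd).sub
      ((measurable_actionUtility w a).comp measurable_snd))

omit [Nonempty A₁] in
lemma abs_swapGain_le (w : A₁ → A₂ → ℝ) (a a' : A₁) (z : MixedStrategy A₁ × MixedStrategy A₂) :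
    |swapGain w a a' z| ≤ 2 * utilityBound w := by
  have hx := mem_Icc_of_mem_stdSimplex z.1.2 a
  rw [swapGain, abs_mul, abs_of_nonneg hx.1]
  refine (mul_le_of_le_one_left (abs_nonneg _) hx.2).trans ((abs_sub _ _).trans ?_)
  linarith [abs_actionUtility_le w a z.2, abs_actionUtility_le w a' z.2]

omit [Nonempty A₁] in
lemma measurable_sum_history {X : Type*} [MeasurableSpace X] {g : ℕ → X → ℝ}
    (hg : ∀ t, Measurable (g t)) (T : ℕ) : Measurable fun h : Fin T → X => ∑ r : Fin T, g r (h r) :=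
  Finset.measurable_sum _ fun r _ => (hg r).comp (measurable_pi_apply r)

lemma abs_sum_history_le {X : Type*} {g : ℕ → X → ℝ} {C : ℝ} (hg : ∀ t z, |g t z| ≤ C) {T : ℕ}
    (h : Fin T → X) : |∑ r : Fin T, g r (h r)| ≤ T * C :=
  (Finset.abs_sum_le_sum_abs _ _).trans
    ((Finset.sum_le_sum fun (r : Fin T) _ => hg r (h r)).trans (by simp))

/-- The bound on the total internal regret of regret matching over `T` rounds. -/
noncomputable def regretBound (w : A₁ → A₂ → ℝ) (T : ℕ) : ℝ :=
  2 * utilityBound w * ∑ t ∈ Finset.range T, explorationRate t +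
    √(T * (potentialConstant w * √T))

/-- Regret matching has sublinear internal regret, uniformly over the algorithms of the opponent. -/
lemma integral_sum_swapGain_le (q : ℕ → PMF 𝒢) (π₂ : Algorithm₂ fb 𝒢)
    (G : BimatrixGame A₁ A₂) (s₁ s₂ : 𝒢) (T : ℕ) (a a' : A₁) :
    ∫ h, ∑ r, swapGain G.U₁ a a' (h r)
      ∂(trajectory q (regretMatchingAlgorithm fb 𝒢) π₂ G s₁ s₂ T) ≤ regretBound G.U₁ T := by
  set μ := trajectory q (regretMatchingAlgorithm fb 𝒢) π₂ G s₁ s₂ T with hμ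
  have hmS : ∀ t, Measurable fun h : Fin t → MixedStrategy A₁ × MixedStrategy A₂ =>
      ∑ r, swapGain G.U₁ a a' (h r) := fun t =>
    measurable_sum_history (g := fun _ => swapGain G.U₁ a a') (fun _ => measurable_swapGain _ _ _) t
  have hbS : ∀ t, ∀ h : Fin t → MixedStrategy A₁ × MixedStrategy A₂,
      |∑ r, swapGain G.U₁ a a' (h r)| ≤ t * (2 * utilityBound G.U₁) := fun t h =>
    abs_sum_history_le (g := fun _ => swapGain G.U₁ a a') (fun _ => abs_swapGain_le _ _ _) h
  have hmR : ∀ t, Measurable fun h : Fin t → MixedStrategy A₁ × MixedStrategy A₂ =>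
      historyRegret G.U₁ h a a' := fun t =>
    (measurable_pi_apply a').comp ((measurable_pi_apply a).comp (measurable_historyRegret G.U₁ t))
  have hbV : ∀ t, ∃ C, ∀ h : Fin t → MixedStrategy A₁ × MixedStrategy A₂,
      |∑ r, swapGain G.U₁ a a' (h r) - historyRegret G.U₁ h a a'| ≤ C := by
    intro t
    obtain ⟨C, hC⟩ := exists_abs_historyRegret_le G.U₁ t
    exact ⟨_, fun h => (abs_sub _ _).trans (add_le_add (hbS t h) (hC h a a'))⟩
  -- The regret in excess of its estimate grows by at most the cost of exploration.
  have key := integral_trajectory_le q (regretMatchingAlgorithm fb 𝒢) π₂ G s₁ s₂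
    (fun t h => ∑ r, swapGain G.U₁ a a' (h r) - historyRegret G.U₁ h a a')
    (fun t => 2 * utilityBound G.U₁ * explorationRate t)
    (fun t => (hmS t).sub (hmR t)) hbV ?_ T
  · obtain ⟨C, hC⟩ := exists_abs_historyRegret_le G.U₁ T
    have hiS : Integrable (fun h : Fin T → MixedStrategy A₁ × MixedStrategy A₂ =>
        ∑ r, swapGain G.U₁ a a' (h r)) μ := integrable_of_measurable_of_abs_le (hmS T) (hbS T)
    have hiR : Integrable (fun h : Fin T → MixedStrategy A₁ × MixedStrategy A₂ =>
        historyRegret G.U₁ h a a') μ :=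
      integrable_of_measurable_of_abs_le (hmR T) fun h => hC h a a'
    rw [integral_sub hiS hiR, ← Finset.mul_sum] at key
    simp only [Finset.univ_eq_empty, Finset.sum_empty, historyRegret, regretState, Pi.zero_apply,
      sub_zero, zero_add] at key
    suffices hR : ∫ h, historyRegret G.U₁ h a a' ∂μ ≤ √(T * (potentialConstant G.U₁ * √T)) by
      unfold regretBound
      unfold historyRegret at hR
      linarith
    rcases Nat.eq_zero_or_pos T with rfl | hT
    · simp [historyRegret, regretState]
    set l := √(T * (potentialConstant G.U₁ * √T)) with hl
    have hpos : 0 < T * (potentialConstant G.U₁ * √T) := by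
      have := one_le_potentialConstant G.U₁
      have : (0 : ℝ) < T := by exact_mod_cast hT
      positivity
    have hl0 : 0 < l := Real.sqrt_pos.2 hpos
    have hl2 : l ^ 2 = T * (potentialConstant G.U₁ * √T) := Real.sq_sqrt hpos.le
    obtain ⟨C', hC'⟩ := exists_abs_regretPotential_le G.U₁ T
    have hiP : Integrable (fun h : Fin T → MixedStrategy A₁ × MixedStrategy A₂ =>
        regretPotential (historyRegret G.U₁ h)) μ :=
      integrable_of_measurable_of_abs_le
        (measurable_regretPotential.comp (measurable_historyRegret _ T)) hC'
    -- By the arithmetic-geometric mean inequality; `l` balances the two terms in expectation.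
    have hpt : ∀ h : Fin T → MixedStrategy A₁ × MixedStrategy A₂, historyRegret G.U₁ h a a' ≤
        l / 2 + (2 * l)⁻¹ * regretPotential (historyRegret G.U₁ h) := by
      intro h
      set x := historyRegret G.U₁ h a a' with hx
      have h1 : (max x 0) ^ 2 ≤ regretPotential (historyRegret G.U₁ h) :=
        (Finset.single_le_sum (f := fun a' => (max (historyRegret G.U₁ h a a') 0) ^ 2)
          (fun _ _ => sq_nonneg _) (Finset.mem_univ a')).trans
          (Finset.single_le_sum (f := fun a => ∑ a', (max (historyRegret G.U₁ h a a') 0) ^ 2)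
            (fun _ _ => Finset.sum_nonneg fun _ _ => sq_nonneg _) (Finset.mem_univ a))
      have h2 : max x 0 ≤ l / 2 + (2 * l)⁻¹ * (max x 0) ^ 2 := by
        have : l / 2 + (2 * l)⁻¹ * (max x 0) ^ 2 - max x 0 = (2 * l)⁻¹ * (l - max x 0) ^ 2 := by
          field_simp
          ring
        have : 0 ≤ (2 * l)⁻¹ * (l - max x 0) ^ 2 := by positivity
        linarith
      calc x ≤ max x 0 := le_max_left _ _
        _ ≤ _ := h2
        _ ≤ _ := by gcongr
    calc _ ≤ ∫ h, (l / 2 + (2 * l)⁻¹ * regretPotential (historyRegret G.U₁ h)) ∂μ :=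
          integral_mono hiR ((integrable_const _).add (hiP.const_mul _)) hpt
      _ = l / 2 + (2 * l)⁻¹ * ∫ h, regretPotential (historyRegret G.U₁ h) ∂μ := by
          rw [integral_add (integrable_const _) (hiP.const_mul _), integral_const_mul]
          simp
      _ ≤ l / 2 + (2 * l)⁻¹ * l ^ 2 := by
          rw [hl2]
          gcongr
          exact integral_regretPotential_le q π₂ G s₁ s₂ T
      _ = l := by field_simp; ring
  · intro t h
    obtain ⟨C, hC⟩ := hbV (t + 1)
    have hm : Measurable fun z =>
        ∑ r, swapGain G.U₁ a a'
          (Fin.snoc (α := fun _ => MixedStrategy A₁ × MixedStrategy A₂) h z r) -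
        historyRegret G.U₁
          (Fin.snoc (α := fun _ => MixedStrategy A₁ × MixedStrategy A₂) h z) a a' :=
      ((hmS (t + 1)).sub (hmR (t + 1))).comp
        ((measurable_snoc_history t).comp measurable_prodMk_left)
    refine integral_roundKernel_le_of_left _ _ _ _ _ _ _ _ hm (fun z => hC _) fun y => ?_
    rw [integral_regretMatchingAlgorithm]
    have h1 := sum_playProb_mul_sub_regretIncrement_le t (historyRegret G.U₁ h)
      (w := fun c => actionUtility G.U₁ c y) (fun c => abs_actionUtility_le G.U₁ c y) a a'
    have h2 := (playProb_mem_stdSimplex t (historyRegret G.U₁ h)).2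
    simp only [historyRegret_snoc, mixedUtility_pureStrategy, Fin.sum_univ_castSucc,
      Fin.snoc_castSucc, Fin.snoc_last, Pi.add_apply]
    calc _ = ∑ c, playProb t (historyRegret G.U₁ h) c *
          ((∑ r, swapGain G.U₁ a a' (h r) - historyRegret G.U₁ h a a') +
          ((pureStrategy c).1 a * (actionUtility G.U₁ a' y - actionUtility G.U₁ a y) -
            regretIncrement t (historyRegret G.U₁ h) (pureStrategy c)
              (actionUtility G.U₁ c y) a a')) :=
          Finset.sum_congr rfl fun c _ => by rw [swapGain]; ring
      _ ≤ _ := by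
          simp only [mul_add (playProb t _ _), Finset.sum_add_distrib]
          rw [← Finset.sum_mul, h2, one_mul]
          linarith

omit [Nonempty A₁] in
lemma regretBound_nonneg (w : A₁ → A₂ → ℝ) (T : ℕ) : 0 ≤ regretBound w T := by
  have := utilityBound_nonneg w
  have : 0 ≤ ∑ t ∈ Finset.range T, explorationRate t :=
    Finset.sum_nonneg fun t _ => (explorationRate_pos t).le
  unfold regretBound
  positivity

omit [Nonempty A₁] in
lemma tendsto_regretBound_div (w : A₁ → A₂ → ℝ) :
    Tendsto (fun T : ℕ => regretBound w T / T) atTop (𝓝 0) := by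
  have h1 : Tendsto (fun T : ℕ => 2 * utilityBound w *
      ((T : ℝ)⁻¹ * ∑ t ∈ Finset.range T, explorationRate t)) atTop (𝓝 0) := by
    simpa using tendsto_explorationRate.cesaro.const_mul (2 * utilityBound w)
  have h2 : Tendsto (fun T : ℕ => √(potentialConstant w * (√T)⁻¹)) atTop (𝓝 0) := by
    have : Tendsto (fun T : ℕ => potentialConstant w * (√(T : ℝ))⁻¹) atTop (𝓝 0) := by
      simpa using (tendsto_inv_atTop_zero.comp
        (Real.tendsto_sqrt_atTop.comp tendsto_natCast_atTop_atTop)).const_mul (potentialConstant w)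
    have h := (Real.continuous_sqrt.tendsto 0).comp this
    rwa [Real.sqrt_zero] at h
  have h3 := h1.add h2
  rw [add_zero] at h3
  refine h3.congr' ?_
  filter_upwards [eventually_gt_atTop 0] with T hT
  have hT' : (0 : ℝ) < T := by exact_mod_cast hT
  have h4 : √(T * (potentialConstant w * √T)) / T = √(potentialConstant w * (√T)⁻¹) := by
    rw [div_eq_iff hT'.ne', ← Real.sqrt_sq hT'.le, ← Real.sqrt_mul
      (by have := one_le_potentialConstant w; positivity), Real.sqrt_sq hT'.le]
    congr 1
    have hs : √(T : ℝ) ≠ 0 := (Real.sqrt_pos.2 hT').ne'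
    field_simp
    rw [Real.sq_sqrt hT'.le, mul_comm]
  rw [regretBound, add_div, h4]
  ring

end Algorithm

/-! ### Geometry of the Stackelberg value -/

namespace BimatrixGame

variable {A₁ : Type u} {A₂ : Type v} [Fintype A₁] [Fintype A₂]

omit [Fintype A₁] in
lemma continuous_actionUtility (w : A₁ → A₂ → ℝ) (a : A₁) : Continuous (actionUtility w a) := by
  unfold actionUtility
  refine continuous_finsetSum _ fun b _ => ?_
  exact ((continuous_apply b).comp continuous_subtype_val).mul continuous_const

omit [Fintype A₁] in
lemma mem_bestResponse₁ (G : BimatrixGame A₁ A₂) {y : MixedStrategy A₂} {a : A₁} :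
    a ∈ G.bestResponse₁ y ↔ ∀ a', actionUtility G.U₁ a' y ≤ actionUtility G.U₁ a y :=
  Iff.rfl

lemma isCompact_setOf_committedUtility (G : BimatrixGame A₁ A₂) :
    IsCompact {v | ∃ y : MixedStrategy A₂, ∃ a ∈ G.bestResponse₁ y, v = ∑ b, y.1 b * G.U₂ a b} := by
  have h : {v | ∃ y : MixedStrategy A₂, ∃ a ∈ G.bestResponse₁ y, v = ∑ b, y.1 b * G.U₂ a b} =
      ⋃ a, actionUtility G.U₂ a '' {y | a ∈ G.bestResponse₁ y} := by
    ext v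
    simp only [Set.mem_ofPred_eq, Set.mem_iUnion, Set.mem_image, actionUtility]
    exact ⟨fun ⟨y, a, ha, hv⟩ => ⟨a, y, ha, hv.symm⟩, fun ⟨a, y, ha, hv⟩ => ⟨y, a, ha, hv.symm⟩⟩
  rw [h]
  refine isCompact_iUnion fun a => IsCompact.image ?_ (continuous_actionUtility _ a)
  refine IsClosed.isCompact ?_
  simp only [mem_bestResponse₁, Set.ofPred_forall]
  exact isClosed_iInter fun a' =>
    isClosed_le (continuous_actionUtility _ _) (continuous_actionUtility _ _)

/-- The second player never gets more than the Stackelberg value from a best response to her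
strategy. -/
lemma actionUtility_le_stackVal₂ (G : BimatrixGame A₁ A₂) {y : MixedStrategy A₂} {a : A₁}
    (ha : a ∈ G.bestResponse₁ y) : actionUtility G.U₂ a y ≤ G.stackVal₂ :=
  le_csSup G.isCompact_setOf_committedUtility.bddAbove ⟨y, a, ha, rfl⟩

/-- The Stackelberg value is attained. -/
lemma exists_actionUtility_eq_stackVal₂ [Nonempty A₁] [Nonempty A₂] (G : BimatrixGame A₁ A₂) :
    ∃ (y : MixedStrategy A₂) (a : A₁), a ∈ G.bestResponse₁ y ∧
      actionUtility G.U₂ a y = G.stackVal₂ := by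
  obtain ⟨y₀⟩ : Nonempty (MixedStrategy A₂) := ⟨⟨_, uniform_mem_stdSimplex⟩⟩
  obtain ⟨a₀, ha₀⟩ := Finite.exists_max fun a => actionUtility G.U₁ a y₀
  obtain ⟨y, a, ha, hv⟩ := G.isCompact_setOf_committedUtility.sSup_mem ⟨_, y₀, a₀, ha₀, rfl⟩
  exact ⟨y, a, ha, hv.symm⟩

/-- An action that is not weakly dominated is the unique best response to some mixed strategy: the
advantages of the mixtures of the other actions form a compact convex set that misses the
nonnegative orthant, and a separating hyperplane is, up to normalization, such a strategy. -/
lemma exists_unique_bestResponse₁ [Nonempty A₂] (G : BimatrixGame A₁ A₂) {a₀ : A₁}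
    (h : ¬ G.WeaklyDominated₁ a₀) :
    ∃ (y : MixedStrategy A₂) (g : ℝ), 0 < g ∧
      ∀ a, a ≠ a₀ → actionUtility G.U₁ a y + g ≤ actionUtility G.U₁ a₀ y := by
  classical
  by_cases hA : ∃ a₁, a₁ ≠ a₀
  swap
  · push Not at hA
    exact ⟨⟨_, uniform_mem_stdSimplex⟩, 1, one_pos, fun a ha => absurd (hA a) ha⟩
  obtain ⟨a₁, ha₁⟩ := hA
  set L : (A₁ → ℝ) →ₗ[ℝ] (A₂ → ℝ) :=
    { toFun := fun x b => ∑ a, x a * (G.U₁ a b - G.U₁ a₀ b)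
      map_add' := fun x x' => by
        funext b
        simp [add_mul, Finset.sum_add_distrib]
      map_smul' := fun c x => by
        funext b
        simp [Finset.mul_sum, mul_assoc] } with hL
  have hLapp : ∀ x b, L x b = ∑ a, x a * (G.U₁ a b - G.U₁ a₀ b) := fun x b => rfl
  set S : Set (A₁ → ℝ) := stdSimplex ℝ A₁ ∩ {x | x a₀ = 0} with hS
  have hSc : IsCompact S :=
    (isCompact_stdSimplex ℝ A₁).inter_right (isClosed_eq (continuous_apply a₀) continuous_const)
  have hSconv : Convex ℝ S := by
    refine (convex_stdSimplex ℝ A₁).inter ?_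
    intro x hx x' hx' c d _ _ _
    simp only [Set.mem_ofPred_eq] at hx hx' ⊢
    simp [hx, hx']
  have hLc : Continuous L := L.continuous_of_finiteDimensional
  set Q : Set (A₂ → ℝ) := {z | ∀ b, 0 ≤ z b} with hQ
  have hQconv : Convex ℝ Q := by
    intro z hz z' hz' c d hc hd _ b
    have := hz b
    have := hz' b
    simp only [Pi.add_apply, Pi.smul_apply, smul_eq_mul]
    positivity
  have hQc : IsClosed Q := by
    simp only [hQ, Set.ofPred_forall]
    exact isClosed_iInter fun b => isClosed_le continuous_const (continuous_apply b)
  have hdisj : Disjoint (L '' S) Q := by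
    rw [Set.disjoint_left]
    rintro _ ⟨x, ⟨hx, hx0⟩, rfl⟩ hq
    refine h ⟨⟨x, hx⟩, hx0, fun b => ?_⟩
    have := hq b
    rw [hLapp] at this
    simp only [mul_sub, Finset.sum_sub_distrib, ← Finset.sum_mul, hx.2, one_mul] at this
    linarith
  obtain ⟨f, c, d, hfK, hcd, hfQ⟩ := geometric_hahn_banach_compact_closed
    (hSconv.linear_image L) (hSc.image hLc) hQconv hQc hdisj
  have hd : d < 0 := by simpa using hfQ 0 fun b => le_rfl
  have hpos : ∀ b, 0 ≤ f (Pi.single b 1) := by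
    intro b
    by_contra! hb
    have h1 := hfQ ((d / f (Pi.single b 1)) • Pi.single b 1) fun b' => by
      have h2 : 0 ≤ d / f (Pi.single b 1) := div_nonneg_of_nonpos hd.le hb.le
      have h3 : (0 : ℝ) ≤ (Pi.single b 1 : A₂ → ℝ) b' := (single_mem_stdSimplex ℝ b).1 b'
      simpa using mul_nonneg h2 h3
    rw [map_smul, smul_eq_mul, div_mul_cancel₀ _ hb.ne] at h1
    exact lt_irrefl _ h1
  have hf : ∀ z : A₂ → ℝ, f z = ∑ b, z b * f (Pi.single b 1) := by
    intro z
    have := LinearMap.pi_apply_eq_sum_univ (f : (A₂ → ℝ) →ₗ[ℝ] ℝ) z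
    simp only [ContinuousLinearMap.coe_coe, smul_eq_mul] at this
    rw [this]
    refine Finset.sum_congr rfl fun b _ => ?_
    congr 2
    funext b'
    simp [Pi.single_apply, eq_comm]
  have hKa : ∀ a, a ≠ a₀ → f (fun b => G.U₁ a b - G.U₁ a₀ b) < c := by
    intro a ha
    refine hfK _ ⟨Pi.single a 1, ⟨single_mem_stdSimplex ℝ a, ?_⟩, ?_⟩
    · simp [ha.symm]
    · funext b
      rw [hLapp]
      simp [Pi.single_apply]
  set s := ∑ b, f (Pi.single b 1) with hs
  have hs0 : 0 < s := by
    refine (Finset.sum_nonneg fun b _ => hpos b).lt_of_ne fun h0 => ?_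
    have hz : ∀ b, f (Pi.single b 1) = 0 := fun b =>
      (Finset.sum_eq_zero_iff_of_nonneg fun b _ => hpos b).1 h0.symm b (Finset.mem_univ b)
    have := hKa a₁ ha₁
    rw [hf] at this
    simp only [hz, mul_zero, Finset.sum_const_zero] at this
    linarith
  obtain ⟨y, hy⟩ : ∃ y : MixedStrategy A₂, ∀ b, y.1 b = f (Pi.single b 1) / s :=
    ⟨⟨fun b => f (Pi.single b 1) / s, fun b => div_nonneg (hpos b) hs0.le, by
      rw [← Finset.sum_div]; exact div_self hs0.ne'⟩, fun _ => rfl⟩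
  refine ⟨y, -c / s, div_pos (by linarith) hs0, fun a ha => ?_⟩
  have h1 := hKa a ha
  rw [hf] at h1
  have h2 : actionUtility G.U₁ a y - actionUtility G.U₁ a₀ y =
      (∑ b, (G.U₁ a b - G.U₁ a₀ b) * f (Pi.single b 1)) / s := by
    simp only [actionUtility, hy]
    rw [← Finset.sum_sub_distrib, Finset.sum_div]
    exact Finset.sum_congr rfl fun b _ => by ring
  have h3 := div_lt_div_of_pos_right h1 hs0
  rw [← h2] at h3
  rw [neg_div]
  linarith

/-- The internal regret for not having played `a'` in place of `a` when the pairs of actions have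
frequencies `φ`. -/
noncomputable def internalRegret (G : BimatrixGame A₁ A₂) (φ : A₁ × A₂ → ℝ) (a a' : A₁) : ℝ :=
  ∑ b, φ (a, b) * (G.U₁ a' b - G.U₁ a b)

/-- A distribution without internal regret of the first player is a mixture of best responses to
strategies of the second player, who therefore gets at most the Stackelberg value. -/
lemma sum_mul_U₂_le_stackVal₂ (G : BimatrixGame A₁ A₂) {φ : A₁ × A₂ → ℝ}
    (hφ : φ ∈ stdSimplex ℝ (A₁ × A₂)) (hreg : ∀ a a', G.internalRegret φ a a' ≤ 0) :
    ∑ z, φ z * G.U₂ z.1 z.2 ≤ G.stackVal₂ := by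
  have hsum : ∑ a, ∑ b, φ (a, b) = 1 := by
    rw [← Fintype.sum_prod_type]
    exact hφ.2
  have h : ∀ a, ∑ b, φ (a, b) * G.U₂ a b ≤ (∑ b, φ (a, b)) * G.stackVal₂ := by
    intro a
    set s := ∑ b, φ (a, b) with hs
    have hs0 : 0 ≤ s := Finset.sum_nonneg fun b _ => hφ.1 _
    rcases hs0.eq_or_lt with h0 | hpos
    · have hz : ∀ b, φ (a, b) = 0 := fun b =>
        (Finset.sum_eq_zero_iff_of_nonneg fun b _ => hφ.1 (a, b)).1 h0.symm b (Finset.mem_univ b)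
      simp [hz, ← h0]
    · set y : MixedStrategy A₂ := ⟨fun b => φ (a, b) / s, fun b => div_nonneg (hφ.1 _) hs0, by
        rw [← Finset.sum_div]; exact div_self hpos.ne'⟩ with hy
      have hmul : ∀ (w : A₁ → A₂ → ℝ) a', s * actionUtility w a' y = ∑ b, φ (a, b) * w a' b := by
        intro w a'
        rw [actionUtility, Finset.mul_sum]
        refine Finset.sum_congr rfl fun b _ => ?_
        change s * (φ (a, b) / s * w a' b) = _
        field_simp
      rw [← hmul G.U₂]
      refine mul_le_mul_of_nonneg_left (G.actionUtility_le_stackVal₂ fun a' => ?_) hs0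
      refine le_of_mul_le_mul_left ?_ hpos
      have h1 := hreg a a'
      simp only [internalRegret, mul_sub, Finset.sum_sub_distrib] at h1
      change s * actionUtility G.U₁ a' y ≤ s * actionUtility G.U₁ a y
      rw [hmul, hmul]
      linarith
  rw [Fintype.sum_prod_type]
  calc _ ≤ ∑ a, (∑ b, φ (a, b)) * G.stackVal₂ := Finset.sum_le_sum fun a _ => h a
    _ = G.stackVal₂ := by rw [← Finset.sum_mul, hsum, one_mul]

/-- If the internal regrets of the first player are small, then the second player gets hardly more
than the Stackelberg value. -/
lemma exists_forall_sum_mul_U₂_le (G : BimatrixGame A₁ A₂) {η : ℝ} (hη : 0 < η) :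
    ∃ ρ > 0, ∀ φ ∈ stdSimplex ℝ (A₁ × A₂), (∀ a a', G.internalRegret φ a a' ≤ ρ) →
      ∑ z, φ z * G.U₂ z.1 z.2 < G.stackVal₂ + η := by
  -- The total positive regret is continuous and positive on the compact set of distributions that
  -- give the second player more, so it is bounded away from zero there.
  set F : (A₁ × A₂ → ℝ) → ℝ := fun φ => ∑ a, ∑ a', max (G.internalRegret φ a a') 0 with hF
  have hFc : Continuous F := by
    unfold F internalRegret
    fun_prop
  have hUc : Continuous fun φ : A₁ × A₂ → ℝ => ∑ z, φ z * G.U₂ z.1 z.2 := by fun_prop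
  set K : Set (A₁ × A₂ → ℝ) :=
    stdSimplex ℝ (A₁ × A₂) ∩ {φ | G.stackVal₂ + η ≤ ∑ z, φ z * G.U₂ z.1 z.2} with hK
  have hKc : IsCompact K :=
    (isCompact_stdSimplex ℝ _).inter_right (isClosed_le continuous_const hUc)
  rcases K.eq_empty_or_nonempty with hKe | hKne
  · refine ⟨1, one_pos, fun φ hφ _ => ?_⟩
    by_contra! hcon
    have : φ ∈ K := ⟨hφ, hcon⟩
    simp [hKe] at this
  obtain ⟨φ₀, hφ₀, hmin⟩ := hKc.exists_isMinOn hKne hFc.continuousOn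
  have hnn : ∀ φ a, 0 ≤ ∑ a', max (G.internalRegret φ a a') 0 := fun φ a =>
    Finset.sum_nonneg fun _ _ => le_max_right _ _
  have hF0 : 0 < F φ₀ := by
    refine (Finset.sum_nonneg fun a _ => hnn φ₀ a).lt_of_ne fun h0 => ?_
    have hz : ∀ a a', G.internalRegret φ₀ a a' ≤ 0 := by
      intro a a'
      have h1 := (Finset.sum_eq_zero_iff_of_nonneg fun a _ => hnn φ₀ a).1 h0.symm a
        (Finset.mem_univ a)
      have h2 := (Finset.sum_eq_zero_iff_of_nonneg fun a' _ => le_max_right _ _).1 h1 a'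
        (Finset.mem_univ a')
      exact (le_max_left _ _).trans h2.le
    have := G.sum_mul_U₂_le_stackVal₂ hφ₀.1 hz
    have := hφ₀.2
    simp only [Set.mem_ofPred_eq] at this
    linarith
  refine ⟨F φ₀ / (2 * (1 + (Fintype.card A₁ : ℝ) ^ 2)), by positivity, fun φ hφ hreg => ?_⟩
  by_contra! hcon
  have h1 : F φ₀ ≤ F φ := hmin (⟨hφ, hcon⟩ : φ ∈ K)
  set ρ := F φ₀ / (2 * (1 + (Fintype.card A₁ : ℝ) ^ 2)) with hρ
  have hρ0 : 0 < ρ := by positivity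
  have h2 : F φ ≤ (Fintype.card A₁ : ℝ) ^ 2 * ρ := by
    calc F φ ≤ ∑ _a : A₁, ∑ _a' : A₁, ρ := Finset.sum_le_sum fun a _ =>
          Finset.sum_le_sum fun a' _ => max_le (hreg a a') hρ0.le
      _ = _ := by simp; ring
  have h3 : F φ₀ = 2 * (1 + (Fintype.card A₁ : ℝ) ^ 2) * ρ := by
    rw [hρ]
    field_simp
  nlinarith [sq_nonneg (Fintype.card A₁ : ℝ)]

end BimatrixGame

/-! ### Commitments with a vanishing margin -/

section Commitment

/-- Every nonnegative null sequence is dominated by an antitone null sequence of positive numbers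
that vanishes more slowly. -/
lemma exists_antitone_tendsto_div {σ : ℕ → ℝ} (hσ : Tendsto σ atTop (𝓝 0)) (hσ0 : ∀ T, 0 ≤ σ T) :
    ∃ ε : ℕ → ℝ, Antitone ε ∧ (∀ t, 0 < ε t) ∧ (∀ t, ε t ≤ 1) ∧ Tendsto ε atTop (𝓝 0) ∧
      Tendsto (fun T => σ T / ε T) atTop (𝓝 0) := by
  -- The square root of the suprema of the tails; the second summand makes it positive.
  set τ : ℕ → ℝ := fun T => σ T + 1 / ((T : ℝ) + 1) with hτ
  have hτlim : Tendsto τ atTop (𝓝 0) := by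
    simpa [hτ] using hσ.add tendsto_one_div_add_atTop_nhds_zero_nat
  have hτpos : ∀ T, 0 < τ T := fun T => add_pos_of_nonneg_of_pos (hσ0 T) (by positivity)
  obtain ⟨C, hC⟩ := hτlim.bddAbove_range
  have hbdd : ∀ T, BddAbove (Set.range fun s => τ (T + s)) := fun T =>
    ⟨C, by rintro _ ⟨s, rfl⟩; exact hC ⟨_, rfl⟩⟩
  set b : ℕ → ℝ := fun T => ⨆ s, τ (T + s) with hb
  have hτb : ∀ T, τ T ≤ b T := fun T => le_ciSup (hbdd T) 0
  have hbpos : ∀ T, 0 < b T := fun T => (hτpos T).trans_le (hτb T)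
  have hbanti : Antitone b := by
    intro S T hST
    refine ciSup_le fun s => ?_
    obtain ⟨k, rfl⟩ := Nat.exists_eq_add_of_le hST
    rw [add_assoc]
    exact le_ciSup (hbdd S) (k + s)
  have hblim : Tendsto b atTop (𝓝 0) := by
    rw [Metric.tendsto_atTop]
    intro η hη
    obtain ⟨N, hN⟩ := Metric.tendsto_atTop.1 hτlim (η / 2) (by positivity)
    refine ⟨N, fun T hT => ?_⟩
    have h1 : b T ≤ η / 2 := ciSup_le fun s => by
      have := hN (T + s) (by omega)
      rw [Real.dist_eq, sub_zero] at this
      exact (le_abs_self _).trans this.le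
    rw [Real.dist_eq, sub_zero, abs_of_pos (hbpos T)]
    linarith
  have hsq : Tendsto (fun T => √(b T)) atTop (𝓝 0) := by
    have h := (Real.continuous_sqrt.tendsto 0).comp hblim
    rwa [Real.sqrt_zero] at h
  refine ⟨fun T => min 1 √(b T), fun S T hST => min_le_min_left _ (Real.sqrt_le_sqrt (hbanti hST)),
    fun t => lt_min one_pos (Real.sqrt_pos.2 (hbpos t)), fun t => min_le_left _ _, ?_, ?_⟩
  · simpa using (tendsto_const_nhds (x := (1 : ℝ))).min hsq
  · refine squeeze_zero' (.of_forall fun T => div_nonneg (hσ0 T)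
      (le_min zero_le_one (Real.sqrt_nonneg _))) ?_ hsq
    filter_upwards [hsq.eventually (gt_mem_nhds one_pos)] with T hT
    rw [min_eq_right hT.le, div_le_iff₀ (Real.sqrt_pos.2 (hbpos T)),
      Real.mul_self_sqrt (hbpos T).le]
    refine le_trans ?_ (hτb T)
    have : 0 ≤ 1 / ((T : ℝ) + 1) := by positivity
    simp only [hτ]
    linarith

variable {A₁ : Type u} {A₂ : Type v} [Fintype A₁] [Fintype A₂]

/-- A sequence of strategies of the second player to which one and the same action of the first
player is the unique best response, by a margin `gap t` that vanishes, if at all, more slowly than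
`σ`, and against which this action asymptotically gives the second player her Stackelberg value. -/
structure BimatrixGame.Commitment (G : BimatrixGame A₁ A₂) (σ : ℕ → ℝ) where
  strategy : ℕ → MixedStrategy A₂
  action : A₁
  gap : ℕ → ℝ
  gap_pos : ∀ t, 0 < gap t
  gap_antitone : Antitone gap
  add_gap_le : ∀ t a, a ≠ action →
    actionUtility G.U₁ a (strategy t) + gap t ≤ actionUtility G.U₁ action (strategy t)
  tendsto_utility : Tendsto (fun t => actionUtility G.U₂ action (strategy t)) atTop (𝓝 G.stackVal₂)
  tendsto_div_gap : Tendsto (fun T => σ T / gap T) atTop (𝓝 0)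

/-- In the absence of weakly dominated actions, mixing an optimal commitment with a small weight on
a strategy that makes the induced action the unique best response gives such a sequence. -/
lemma BimatrixGame.nonempty_commitment [Nonempty A₁] [Nonempty A₂] (G : BimatrixGame A₁ A₂)
    (hG : G.NoWeaklyDominatedAction) {σ : ℕ → ℝ} (hσ : Tendsto σ atTop (𝓝 0))
    (hσ0 : ∀ T, 0 ≤ σ T) : Nonempty (G.Commitment σ) := by
  obtain ⟨y, a₀, ha₀, hv⟩ := G.exists_actionUtility_eq_stackVal₂
  obtain ⟨y', g, hg, hy'⟩ := G.exists_unique_bestResponse₁ (hG.1 a₀)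
  obtain ⟨ε, hanti, hpos, hle, hlim, hdiv⟩ := exists_antitone_tendsto_div hσ hσ0
  set z : ℕ → MixedStrategy A₂ := fun t => ⟨(1 - ε t) • y.1 + ε t • y'.1,
    convex_stdSimplex ℝ A₂ y.2 y'.2 (by linarith [hle t]) (hpos t).le (by ring)⟩ with hz
  have hact : ∀ (w : A₁ → A₂ → ℝ) a t, actionUtility w a (z t) =
      (1 - ε t) * actionUtility w a y + ε t * actionUtility w a y' := by
    intro w a t
    simp only [actionUtility, Finset.mul_sum]
    rw [← Finset.sum_add_distrib]
    refine Finset.sum_congr rfl fun b _ => ?_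
    simp only [hz, Pi.add_apply, Pi.smul_apply, smul_eq_mul]
    ring
  refine ⟨⟨z, a₀, fun t => ε t * g, fun t => mul_pos (hpos t) hg,
    hanti.mul_const hg.le, fun t a ha => ?_, ?_, ?_⟩⟩
  · have h1 := G.mem_bestResponse₁.1 ha₀ a
    have h2 := hy' a ha
    rw [hact, hact]
    nlinarith [hle t, hpos t, mul_le_mul_of_nonneg_left h1 (sub_nonneg.2 (hle t)),
      mul_le_mul_of_nonneg_left h2 (hpos t).le]
  · simp only [hact]
    have := ((hlim.const_sub 1).mul_const (actionUtility G.U₂ a₀ y)).add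
      (hlim.mul_const (actionUtility G.U₂ a₀ y'))
    simpa [hv] using this
  · have := hdiv.div_const g
    simp only [zero_div] at this
    exact this.congr fun T => by rw [div_div]

end Commitment

/-! ### The algorithm of the second player -/

section CommittedAlgorithm

variable {A₁ : Type u} {A₂ : Type v} [Fintype A₁] [Fintype A₂]

/-- Every function of a signal is measurable. -/
lemma measurable_of_family {A₁ : Type u} {A₂ : Type v} {𝒢 : Set (BimatrixGame A₁ A₂)} {X : Type*}
    [MeasurableSpace X] (f : 𝒢 → X) : Measurable f :=
  fun s _ => ⟨Subtype.val '' (f ⁻¹' s), trivial, Set.preimage_image_eq _ Subtype.val_injective⟩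

/-- Playing at every round a strategy that is determined by the external signal of the round. -/
noncomputable def committedAlgorithm (fb : Feedback) (𝒢 : Set (BimatrixGame A₁ A₂))
    (y : 𝒢 → ℕ → MixedStrategy A₂) : Algorithm₂ fb 𝒢 where
  next _ t := Kernel.deterministic (fun z => y z.2 t)
    ((measurable_of_family fun G => y G t).comp measurable_snd)
  isMarkov _ _ := inferInstance

variable {fb : Feedback} {𝒢 : Set (BimatrixGame A₁ A₂)}

lemma committedAlgorithm_comp_apply (q : ℕ → PMF 𝒢) (y : 𝒢 → ℕ → MixedStrategy A₂)
    (G : BimatrixGame A₁ A₂) (s : 𝒢) (t : ℕ) (h : Fin t → MixedStrategy A₁ × MixedStrategy A₂) :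
    ((committedAlgorithm fb 𝒢 y).next s t ∘ₖ
      (Kernel.deterministic (observations₂ fb G) (measurable_observations₂ fb G) ×ₖ
        Kernel.const _ (q t).toMeasure)) h = (q t).toMeasure.map fun G' => y G' t := by
  have hm : Measurable fun G' : 𝒢 => y G' t := measurable_of_family _
  simp only [committedAlgorithm]
  rw [Kernel.deterministic_comp_eq_map, Kernel.map_apply _ (by exact hm.comp measurable_snd),
    Kernel.prod_apply, Kernel.deterministic_apply, Kernel.const_apply]
  have := Measure.map_map hm (measurable_snd (α := Fin t → Observation fb (MixedStrategy A₂)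
    (MixedStrategy A₁))) (μ := (Measure.dirac (observations₂ fb G h)).prod (q t).toMeasure)
  rw [Measure.map_snd_prod] at this
  simpa [Function.comp_def] using this.symm

/-- The probability that the external signal of round `t` is wrong. -/
noncomputable def errorProb (β : ℕ → PMF 𝒢) (G : 𝒢) (t : ℕ) : ℝ :=
  ((β t).toMeasure {G' | G' ≠ G}).toReal

open scoped Classical in
/-- Whether the second player departs from the strategy `y`. -/
noncomputable def departure (y : MixedStrategy A₂) (z : MixedStrategy A₁ × MixedStrategy A₂) : ℝ :=
  if z.2 = y then 0 else 1

lemma measurable_departure (y : MixedStrategy A₂) :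
    Measurable (departure (A₁ := A₁) y) := by
  classical
  unfold departure
  exact Measurable.ite (measurable_snd (measurableSet_singleton y)) measurable_const
    measurable_const

lemma abs_departure_le (y : MixedStrategy A₂) (z : MixedStrategy A₁ × MixedStrategy A₂) :
    |departure y z| ≤ 1 := by
  unfold departure
  split_ifs <;> norm_num

lemma integral_sum_departure_le (q : ℕ → PMF 𝒢) (π₁ : Algorithm₁ fb 𝒢)
    (y : 𝒢 → ℕ → MixedStrategy A₂) (G s₁ s₂ : 𝒢) (T : ℕ) :
    ∫ h, ∑ r : Fin T, departure (y G r) (h r)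
      ∂(trajectory q π₁ (committedAlgorithm fb 𝒢 y) G.1 s₁ s₂ T) ≤
      ∑ t ∈ Finset.range T, errorProb q G t := by
  have hm : ∀ t, Measurable fun h : Fin t → MixedStrategy A₁ × MixedStrategy A₂ =>
      ∑ r : Fin t, departure (y G r) (h r) := fun t =>
    measurable_sum_history (g := fun r => departure (y G r)) (fun r => measurable_departure _) t
  have hb : ∀ t, ∀ h : Fin t → MixedStrategy A₁ × MixedStrategy A₂,
      |∑ r : Fin t, departure (y G r) (h r)| ≤ t * 1 := fun t h =>
    abs_sum_history_le (g := fun r => departure (y G r)) (fun r => abs_departure_le _) h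
  have key := integral_trajectory_le q π₁ (committedAlgorithm fb 𝒢 y) G.1 s₁ s₂
    (fun t h => ∑ r : Fin t, departure (y G r) (h r)) (errorProb q G) hm (fun t => ⟨_, hb t⟩) ?_ T
  · simpa using key
  · intro t h
    have hm' : Measurable fun z => ∑ r : Fin (t + 1), departure (y G r)
        (Fin.snoc (α := fun _ => MixedStrategy A₁ × MixedStrategy A₂) h z r) :=
      (hm (t + 1)).comp ((measurable_snoc_history t).comp measurable_prodMk_left)
    refine integral_roundKernel_le_of_right _ _ _ _ _ _ _ _ hm' (fun z => hb _ _) fun x => ?_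
    have hm'' : Measurable fun G' : 𝒢 => y G' t := measurable_of_family _
    have hm3 : Measurable fun y' => ∑ r : Fin (t + 1), departure (y G r)
        (Fin.snoc (α := fun _ => MixedStrategy A₁ × MixedStrategy A₂) h (x, y') r) :=
      hm'.comp measurable_prodMk_left
    rw [committedAlgorithm_comp_apply, integral_map hm''.aemeasurable hm3.aestronglyMeasurable]
    simp only [Fin.sum_univ_castSucc, Fin.snoc_castSucc, Fin.snoc_last, Fin.val_castSucc,
      Fin.val_last]
    have hi : Integrable (fun G' : 𝒢 => departure (y G t) (x, y G' t)) (q t).toMeasure :=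
      integrable_of_measurable_of_abs_le (measurable_of_family _) fun _ => abs_departure_le _ _
    rw [integral_add (integrable_const _) hi]
    simp only [integral_const, probReal_univ, smul_eq_mul, one_mul]
    refine add_le_add_right ?_ _
    have hs : MeasurableSet {G' : 𝒢 | G' ≠ G} :=
      ⟨Subtype.val '' {G' : 𝒢 | G' ≠ G}, trivial, Set.preimage_image_eq _ Subtype.val_injective⟩
    calc _ ≤ ∫ G', Set.indicator {G' : 𝒢 | G' ≠ G} (fun _ => (1 : ℝ)) G' ∂(q t).toMeasure := by
          refine integral_mono hi ((integrable_const _).indicator hs) fun G' => ?_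
          by_cases hG : G' = G
          · subst hG
            simp [departure]
          · rw [Set.indicator_of_mem (by exact hG)]
            exact le_of_abs_le (abs_departure_le _ _)
      _ = errorProb q G t := by
          rw [integral_indicator_const _ hs]
          simp [errorProb, Measure.real]

end CommittedAlgorithm

/-! ### Expected payoffs -/

section ExpectedTotal

variable {A₁ : Type u} {A₂ : Type v} [Fintype A₁] [Fintype A₂] {fb : Feedback}

/-- A sequence of measurable functions with a common bound. -/
structure BoundedMeasurable {X : Type*} [MeasurableSpace X] (g : ℕ → X → ℝ) : Prop where
  measurable : ∀ t, Measurable (g t)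
  exists_bound : ∃ C, ∀ t x, |g t x| ≤ C

namespace BoundedMeasurable

variable {X : Type*} [MeasurableSpace X] {g g' : ℕ → X → ℝ}

lemma const (c : ℝ) : BoundedMeasurable fun (_ : ℕ) (_ : X) => c :=
  ⟨fun _ => measurable_const, |c|, fun _ _ => le_rfl⟩

lemma add (hg : BoundedMeasurable g) (hg' : BoundedMeasurable g') :
    BoundedMeasurable fun t x => g t x + g' t x := by
  obtain ⟨C, hC⟩ := hg.exists_bound
  obtain ⟨C', hC'⟩ := hg'.exists_bound
  exact ⟨fun t => (hg.measurable t).add (hg'.measurable t), C + C', fun t x =>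
    (abs_add_le _ _).trans (add_le_add (hC t x) (hC' t x))⟩

lemma const_mul (hg : BoundedMeasurable g) (c : ℝ) : BoundedMeasurable fun t x => c * g t x := by
  obtain ⟨C, hC⟩ := hg.exists_bound
  refine ⟨fun t => (hg.measurable t).const_mul c, |c| * C, fun t x => ?_⟩
  rw [abs_mul]
  exact mul_le_mul_of_nonneg_left (hC t x) (abs_nonneg c)

lemma sum {ι : Type*} (s : Finset ι) {g : ι → ℕ → X → ℝ} (hg : ∀ i, BoundedMeasurable (g i)) :
    BoundedMeasurable fun t x => ∑ i ∈ s, g i t x := by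
  choose C hC using fun i => (hg i).exists_bound
  exact ⟨fun t => Finset.measurable_sum _ fun i _ => (hg i).measurable t, ∑ i ∈ s, C i, fun t x =>
    (Finset.abs_sum_le_sum_abs _ _).trans (Finset.sum_le_sum fun i _ => hC i t x)⟩

end BoundedMeasurable

lemma boundedMeasurable_mixedUtility (w : A₁ → A₂ → ℝ) :
    BoundedMeasurable fun (_ : ℕ) (z : MixedStrategy A₁ × MixedStrategy A₂) =>
      mixedUtility w z.1 z.2 :=
  ⟨fun _ => measurable_mixedUtility w, _, fun _ _ => abs_mixedUtility_le w _ _⟩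

lemma boundedMeasurable_swapGain (w : A₁ → A₂ → ℝ) (a a' : A₁) :
    BoundedMeasurable fun (_ : ℕ) => swapGain w a a' :=
  ⟨fun _ => measurable_swapGain w a a', _, fun _ => abs_swapGain_le w a a'⟩

lemma boundedMeasurable_departure (y : ℕ → MixedStrategy A₂) :
    BoundedMeasurable fun t => departure (A₁ := A₁) (y t) :=
  ⟨fun _ => measurable_departure _, 1, fun _ => abs_departure_le _⟩

lemma boundedMeasurable_apply (a : A₁) :
    BoundedMeasurable fun (_ : ℕ) (z : MixedStrategy A₁ × MixedStrategy A₂) => z.1.1 a := by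
  refine ⟨fun _ => (measurable_stdSimplex_apply a).comp measurable_fst, 1, fun _ z => ?_⟩
  have := mem_Icc_of_mem_stdSimplex z.1.2 a
  rw [abs_of_nonneg this.1]
  exact this.2

lemma boundedMeasurable_mul_apply (a : A₁) (b : A₂) :
    BoundedMeasurable fun (_ : ℕ) (z : MixedStrategy A₁ × MixedStrategy A₂) =>
      z.1.1 a * z.2.1 b := by
  refine ⟨fun _ => ((measurable_stdSimplex_apply a).comp measurable_fst).mul
    ((measurable_stdSimplex_apply b).comp measurable_snd), 1, fun _ z => ?_⟩
  have h := mem_Icc_of_mem_stdSimplex z.1.2 a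
  have h' := mem_Icc_of_mem_stdSimplex z.2.2 b
  rw [abs_of_nonneg (mul_nonneg h.1 h'.1)]
  exact mul_le_one₀ h.2 h'.1 h'.2

lemma boundedMeasurable_actionUtility (w : A₁ → A₂ → ℝ) (a : A₁) (y : ℕ → MixedStrategy A₂) :
    BoundedMeasurable fun t (_ : MixedStrategy A₁ × MixedStrategy A₂) => actionUtility w a (y t) :=
  ⟨fun _ => measurable_const, _, fun _ _ => abs_actionUtility_le w a _⟩

namespace RepeatedBayesianGame

variable (R : RepeatedBayesianGame A₁ A₂) (T : ℕ) (π₁ : Algorithm₁ fb R.family)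
  (π₂ : Algorithm₂ fb R.family) (G : R.family)

/-- The expected sum over the first `T` rounds of a function of the round and the strategy pair. -/
noncomputable def expectedTotal
    (g : ℕ → MixedStrategy A₁ × MixedStrategy A₂ → ℝ) : ℝ :=
  ∫ τ, ∑ r : Fin T, g r (τ r) ∂(R.mixedTrajectory T π₁ π₂ G)

variable {R T π₁ π₂ G} {g g' : ℕ → MixedStrategy A₁ × MixedStrategy A₂ → ℝ}

lemma integrable_sum (hg : BoundedMeasurable g) :
    Integrable (fun τ : Fin T → MixedStrategy A₁ × MixedStrategy A₂ => ∑ r : Fin T, g r (τ r))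
      (R.mixedTrajectory T π₁ π₂ G) := by
  obtain ⟨C, hC⟩ := hg.exists_bound
  exact integrable_of_measurable_of_abs_le (measurable_sum_history hg.measurable T)
    (abs_sum_history_le hC)

lemma expectedTotal_mono (hg : BoundedMeasurable g) (hg' : BoundedMeasurable g')
    (h : ∀ t < T, ∀ z, g t z ≤ g' t z) :
    R.expectedTotal T π₁ π₂ G g ≤ R.expectedTotal T π₁ π₂ G g' :=
  integral_mono (integrable_sum hg) (integrable_sum hg') fun _ =>
    Finset.sum_le_sum fun r _ => h r r.2 _

lemma expectedTotal_add (hg : BoundedMeasurable g) (hg' : BoundedMeasurable g') :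
    R.expectedTotal T π₁ π₂ G (fun t z => g t z + g' t z) =
      R.expectedTotal T π₁ π₂ G g + R.expectedTotal T π₁ π₂ G g' := by
  simp only [expectedTotal, Finset.sum_add_distrib]
  exact integral_add (integrable_sum hg) (integrable_sum hg')

lemma expectedTotal_const_mul (c : ℝ) :
    R.expectedTotal T π₁ π₂ G (fun t z => c * g t z) = c * R.expectedTotal T π₁ π₂ G g := by
  simp only [expectedTotal, ← Finset.mul_sum]
  exact integral_const_mul c _

lemma expectedTotal_sum {ι : Type*} (s : Finset ι)
    {g : ι → ℕ → MixedStrategy A₁ × MixedStrategy A₂ → ℝ} (hg : ∀ i, BoundedMeasurable (g i)) :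
    R.expectedTotal T π₁ π₂ G (fun t z => ∑ i ∈ s, g i t z) =
      ∑ i ∈ s, R.expectedTotal T π₁ π₂ G (g i) := by
  simp only [expectedTotal]
  rw [← integral_finsetSum _ fun i _ => integrable_sum (hg i)]
  exact integral_congr_ae (.of_forall fun _ => Finset.sum_comm)

lemma expectedTotal_of_const (c : ℕ → ℝ) :
    R.expectedTotal T π₁ π₂ G (fun t _ => c t) = ∑ t ∈ Finset.range T, c t := by
  simp [expectedTotal, Finset.sum_range]

lemma avgUtility₁_eq : R.avgUtility₁ T π₁ π₂ G =
    R.expectedTotal T π₁ π₂ G (fun _ z => mixedUtility G.1.U₁ z.1 z.2) / T := by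
  rw [avgUtility₁, expectedTotal, integral_const_mul]
  ring

lemma avgUtility₂_eq : R.avgUtility₂ T π₁ π₂ G =
    R.expectedTotal T π₁ π₂ G (fun _ z => mixedUtility G.1.U₂ z.1 z.2) / T := by
  rw [avgUtility₂, expectedTotal, integral_const_mul]
  ring

lemma abs_expectedTotal_div_le (hg : BoundedMeasurable g) {C : ℝ} (hC : ∀ t z, |g t z| ≤ C) :
    |R.expectedTotal T π₁ π₂ G g / T| ≤ C := by
  -- Strategy pairs exist, as otherwise the trajectories would have total mass zero.
  have hC0 : 0 ≤ C := by
    by_contra! hneg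
    rcases isEmpty_or_nonempty (MixedStrategy A₁ × MixedStrategy A₂) with hE | ⟨⟨z⟩⟩
    · have h1 := IsProbabilityMeasure.measure_univ (μ := R.mixedTrajectory 1 π₁ π₂ G)
      have h2 : (Set.univ : Set (Fin 1 → MixedStrategy A₁ × MixedStrategy A₂)) = ∅ :=
        Set.eq_empty_of_forall_notMem fun τ _ => hE.false (τ 0)
      rw [h2] at h1
      simp at h1
    · linarith [hC 0 z, abs_nonneg (g 0 z)]
  rcases Nat.eq_zero_or_pos T with rfl | hT
  · simpa using hC0
  have hT' : (0 : ℝ) < T := by exact_mod_cast hT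
  rw [abs_div, abs_of_pos hT', div_le_iff₀ hT', mul_comm, abs_le]
  have h1 := expectedTotal_mono (R := R) (T := T) (π₁ := π₁) (π₂ := π₂) (G := G) hg
    (.const C) fun t _ z => le_of_abs_le (hC t z)
  have h2 := expectedTotal_mono (R := R) (T := T) (π₁ := π₁) (π₂ := π₂) (G := G)
    (.const (-C)) hg fun t _ z => neg_le_of_abs_le (hC t z)
  rw [expectedTotal_of_const] at h1 h2
  simp only [Finset.sum_const, Finset.card_range, nsmul_eq_mul] at h1 h2
  exact ⟨by linarith, h1⟩

lemma abs_avgUtility₁_le : |R.avgUtility₁ T π₁ π₂ G| ≤ utilityBound G.1.U₁ := by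
  rw [avgUtility₁_eq]
  exact abs_expectedTotal_div_le (boundedMeasurable_mixedUtility _)
    fun _ _ => abs_mixedUtility_le _ _ _

lemma abs_avgUtility₂_le : |R.avgUtility₂ T π₁ π₂ G| ≤ utilityBound G.1.U₂ := by
  rw [avgUtility₂_eq]
  exact abs_expectedTotal_div_le (boundedMeasurable_mixedUtility _)
    fun _ _ => abs_mixedUtility_le _ _ _

lemma expectedTotal_swapGain_le [Nonempty A₁] (a a' : A₁) :
    R.expectedTotal T (regretMatchingAlgorithm fb R.family) π₂ G
      (fun _ => swapGain G.1.U₁ a a') ≤ regretBound G.1.U₁ T :=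
  integral_mixedTrajectory_le R
    (measurable_sum_history (g := fun _ => swapGain G.1.U₁ a a')
      (fun _ => measurable_swapGain _ _ _) T)
    (abs_sum_history_le (g := fun _ => swapGain G.1.U₁ a a') fun _ => abs_swapGain_le _ _ _)
    fun s₁ s₂ => integral_sum_swapGain_le _ _ _ s₁ s₂ T a a'

lemma expectedTotal_departure_le (y : R.family → ℕ → MixedStrategy A₂) :
    R.expectedTotal T π₁ (committedAlgorithm fb R.family y) G (fun t => departure (y G t)) ≤
      ∑ t ∈ Finset.range T, errorProb (R.external G) G t :=
  integral_mixedTrajectory_le R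
    (measurable_sum_history (g := fun t => departure (y G t)) (fun _ => measurable_departure _) T)
    (abs_sum_history_le (g := fun t => departure (y G t)) fun _ => abs_departure_le _)
    fun s₁ s₂ => integral_sum_departure_le _ _ y G s₁ s₂ T

end RepeatedBayesianGame

end ExpectedTotal

/-! ### Payoffs of the two algorithms and of deviations -/

section Learning

variable {A₁ : Type u} {A₂ : Type v} [Fintype A₁] [Fintype A₂] {fb : Feedback}

namespace RepeatedBayesianGame

variable (R : RepeatedBayesianGame A₁ A₂)

/-- The average regret of the first player plus the average error of the external signals: what
limits how fast the second player may let the margin of the induced best response vanish. -/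
noncomputable def learningError (G : R.family) (T : ℕ) : ℝ :=
  regretBound G.1.U₁ T / T + (∑ t ∈ Finset.range T, errorProb (R.external G) G t) / T

variable {R} {G : R.family}

omit [Fintype A₁] [Fintype A₂] in
lemma sum_errorProb_nonneg (T : ℕ) :
    0 ≤ ∑ t ∈ Finset.range T, errorProb (R.external G) G t :=
  Finset.sum_nonneg fun _ _ => ENNReal.toReal_nonneg

lemma learningError_nonneg (T : ℕ) : 0 ≤ R.learningError G T :=
  add_nonneg (div_nonneg (regretBound_nonneg _ _) T.cast_nonneg)
    (div_nonneg (sum_errorProb_nonneg T) T.cast_nonneg)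

lemma tendsto_learningError (h : SuccessfullyLearns (R.external G) G) :
    Tendsto (R.learningError G) atTop (𝓝 0) := by
  have h1 : Tendsto (errorProb (R.external G) G) atTop (𝓝 0) := by
    have := (ENNReal.tendsto_toReal ENNReal.zero_ne_top).comp h
    rwa [ENNReal.toReal_zero] at this
  have h2 := (tendsto_regretBound_div G.1.U₁).add h1.cesaro
  rw [add_zero] at h2
  refine h2.congr fun T => ?_
  rw [learningError]
  ring

variable [Nonempty A₁]

/-- Against regret matching, whatever she does, the second player asymptotically gets at most her
Stackelberg value. -/
lemma eventually_avgUtility₂_le (G : R.family) (π₂ : ℕ → Algorithm₂ fb R.family) {η : ℝ}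
    (hη : 0 < η) :
    ∀ᶠ T in atTop, R.avgUtility₂ T (regretMatchingAlgorithm fb R.family) (π₂ T) G ≤
      G.1.stackVal₂ + η := by
  obtain ⟨ρ, hρ, hcap⟩ := G.1.exists_forall_sum_mul_U₂_le hη
  filter_upwards [(tendsto_regretBound_div G.1.U₁).eventually (gt_mem_nhds hρ),
    eventually_gt_atTop 0] with T hT hT0
  have hT' : (0 : ℝ) < T := by exact_mod_cast hT0
  set π₁ := regretMatchingAlgorithm fb R.family with hπ₁
  -- the expected frequencies of the pairs of actions
  set φ : A₁ × A₂ → ℝ := fun z =>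
    R.expectedTotal T π₁ (π₂ T) G (fun _ s => s.1.1 z.1 * s.2.1 z.2) / T with hφ
  have hbm : ∀ z : A₁ × A₂, BoundedMeasurable fun (_ : ℕ)
      (s : MixedStrategy A₁ × MixedStrategy A₂) => s.1.1 z.1 * s.2.1 z.2 := fun z =>
    boundedMeasurable_mul_apply z.1 z.2
  have hlin : ∀ c : A₁ × A₂ → ℝ, ∑ z, φ z * c z = R.expectedTotal T π₁ (π₂ T) G
      (fun _ s => ∑ z : A₁ × A₂, c z * (s.1.1 z.1 * s.2.1 z.2)) / T := by
    intro c
    rw [expectedTotal_sum Finset.univ (g := fun (z : A₁ × A₂) _ s => c z * (s.1.1 z.1 * s.2.1 z.2))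
      fun z => (hbm z).const_mul (c z), Finset.sum_div]
    refine Finset.sum_congr rfl fun z _ => ?_
    rw [expectedTotal_const_mul]
    simp only [hφ]
    ring
  have hφS : φ ∈ stdSimplex ℝ (A₁ × A₂) := by
    refine ⟨fun z => div_nonneg ?_ hT'.le, ?_⟩
    · have := expectedTotal_mono (R := R) (T := T) (π₁ := π₁) (π₂ := π₂ T) (G := G) (.const 0)
        (hbm z) fun t _ s => mul_nonneg (s.1.2.1 _) (s.2.2.1 _)
      rw [expectedTotal_of_const] at this
      simpa using this
    · have h := hlin fun _ => 1
      simp only [mul_one, one_mul] at h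
      rw [h]
      have h1 : ∀ s : MixedStrategy A₁ × MixedStrategy A₂,
          ∑ z : A₁ × A₂, s.1.1 z.1 * s.2.1 z.2 = 1 := by
        intro s
        rw [Fintype.sum_prod_type]
        simp only [← Finset.mul_sum, s.2.2.2, mul_one, s.1.2.2]
      simp only [h1]
      rw [expectedTotal_of_const]
      simp [hT'.ne']
  have hU : ∑ z, φ z * G.1.U₂ z.1 z.2 = R.avgUtility₂ T π₁ (π₂ T) G := by
    rw [hlin fun z => G.1.U₂ z.1 z.2, avgUtility₂_eq]
    congr 2
    funext _ s
    rw [Fintype.sum_prod_type, mixedUtility]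
    exact Finset.sum_congr rfl fun a _ => Finset.sum_congr rfl fun b _ => by ring
  have hreg : ∀ a a', G.1.internalRegret φ a a' ≤ ρ := by
    intro a a'
    have h1 : G.1.internalRegret φ a a' =
        R.expectedTotal T π₁ (π₂ T) G (fun _ => swapGain G.1.U₁ a a') / T := by
      have h2 : ∀ s : MixedStrategy A₁ × MixedStrategy A₂, swapGain G.1.U₁ a a' s =
          ∑ b, (G.1.U₁ a' b - G.1.U₁ a b) * (s.1.1 a * s.2.1 b) := by
        intro s
        rw [swapGain, actionUtility, actionUtility, ← Finset.sum_sub_distrib, Finset.mul_sum]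
        exact Finset.sum_congr rfl fun b _ => by ring
      rw [show (fun _ : ℕ => swapGain G.1.U₁ a a') =
          fun _ s => ∑ b, (G.1.U₁ a' b - G.1.U₁ a b) * (s.1.1 a * s.2.1 b) from
          funext fun _ => funext h2, expectedTotal_sum Finset.univ
        (g := fun (b : A₂) _ s => (G.1.U₁ a' b - G.1.U₁ a b) * (s.1.1 a * s.2.1 b))
        fun b => (hbm (a, b)).const_mul _, Finset.sum_div, BimatrixGame.internalRegret]
      refine Finset.sum_congr rfl fun b _ => ?_
      rw [expectedTotal_const_mul]
      simp only [hφ]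
      ring
    rw [h1]
    exact (div_le_div_of_nonneg_right (expectedTotal_swapGain_le a a') hT'.le).trans hT.le
  rw [← hU]
  exact (hcap φ hφS hreg).le

variable {y : R.family → ℕ → MixedStrategy A₂}

/-- Regret matching rarely plays the actions that are not induced by the commitment: each round
in which she plays one of them costs the first player a regret of at least the margin. -/
lemma gap_mul_expectedTotal_le {σ : ℕ → ℝ} (K : G.1.Commitment σ) (hy : y G = K.strategy) (T : ℕ)
    {a : A₁} (ha : a ≠ K.action) :
    K.gap T * R.expectedTotal T (regretMatchingAlgorithm fb R.family)
      (committedAlgorithm fb R.family y) G (fun _ z => z.1.1 a) ≤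
      regretBound G.1.U₁ T + (2 * utilityBound G.1.U₁ + K.gap 0) *
        ∑ t ∈ Finset.range T, errorProb (R.external G) G t := by
  have hd := expectedTotal_departure_le (R := R) (T := T) (G := G)
    (π₁ := regretMatchingAlgorithm fb R.family) y
  have hs := expectedTotal_swapGain_le (R := R) (T := T) (G := G)
    (π₂ := committedAlgorithm fb R.family y) a K.action
  have hB := utilityBound_nonneg G.1.U₁
  have hg0 := K.gap_pos 0
  have h := expectedTotal_mono (R := R) (T := T) (G := G)
    (π₁ := regretMatchingAlgorithm fb R.family) (π₂ := committedAlgorithm fb R.family y)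
    ((boundedMeasurable_apply a).const_mul (K.gap T))
    ((boundedMeasurable_swapGain G.1.U₁ a K.action).add
      ((boundedMeasurable_departure (y G)).const_mul (2 * utilityBound G.1.U₁ + K.gap 0)))
    fun t ht z => by
      have hx := mem_Icc_of_mem_stdSimplex z.1.2 a
      by_cases hz : z.2 = y G t
      · simp only [departure, if_pos hz, mul_zero, add_zero]
        have h1 := K.add_gap_le t a ha
        have h2 := K.gap_antitone ht.le
        rw [swapGain, hz, hy, mul_comm]
        exact mul_le_mul_of_nonneg_left (by linarith) hx.1
      · simp only [departure, if_neg hz, mul_one]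
        have h1 := neg_le_of_abs_le (abs_swapGain_le G.1.U₁ a K.action z)
        have h2 : K.gap T * z.1.1 a ≤ K.gap 0 :=
          (mul_le_of_le_one_right (K.gap_pos T).le hx.2).trans (K.gap_antitone (Nat.zero_le T))
        linarith
  rw [expectedTotal_const_mul, expectedTotal_add (boundedMeasurable_swapGain _ _ _)
    ((boundedMeasurable_departure _).const_mul _), expectedTotal_const_mul] at h
  nlinarith [mul_le_mul_of_nonneg_left hd (by linarith : 0 ≤ 2 * utilityBound G.1.U₁ + K.gap 0)]

omit [Nonempty A₁] in
/-- The committed second player gets at least the utility of the induced action, up to the frequency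
of the other actions and of wrong signals. -/
lemma le_expectedTotal_U₂ {σ : ℕ → ℝ} (K : G.1.Commitment σ) (hy : y G = K.strategy) (T : ℕ)
    (π₁ : Algorithm₁ fb R.family) [DecidableEq A₁] :
    ∑ t ∈ Finset.range T, actionUtility G.1.U₂ K.action (K.strategy t) ≤
      R.expectedTotal T π₁ (committedAlgorithm fb R.family y) G
        (fun _ z => mixedUtility G.1.U₂ z.1 z.2) +
      2 * utilityBound G.1.U₂ * (∑ a ∈ Finset.univ.erase K.action,
        R.expectedTotal T π₁ (committedAlgorithm fb R.family y) G (fun _ z => z.1.1 a) +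
        ∑ t ∈ Finset.range T, errorProb (R.external G) G t) := by
  have hd := expectedTotal_departure_le (R := R) (T := T) (G := G) (π₁ := π₁) y
  have hB := utilityBound_nonneg G.1.U₂
  have hbm := BoundedMeasurable.sum (Finset.univ.erase K.action)
    fun a : A₁ => boundedMeasurable_apply (A₂ := A₂) a
  have h := expectedTotal_mono (R := R) (T := T) (G := G)
    (π₁ := π₁) (π₂ := committedAlgorithm fb R.family y)
    (boundedMeasurable_actionUtility G.1.U₂ K.action K.strategy)
    ((boundedMeasurable_mixedUtility G.1.U₂).add
      ((hbm.add (boundedMeasurable_departure (y G))).const_mul (2 * utilityBound G.1.U₂)))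
    fun t _ z => by
      have hx : 0 ≤ ∑ a ∈ Finset.univ.erase K.action, z.1.1 a :=
        Finset.sum_nonneg fun a _ => z.1.2.1 a
      by_cases hz : z.2 = y G t
      · simp only [departure, if_pos hz, add_zero]
        rw [mixedUtility_eq, hz, hy]
        have h1 : actionUtility G.1.U₂ K.action (K.strategy t) -
            ∑ a, z.1.1 a * actionUtility G.1.U₂ a (K.strategy t) =
            ∑ a, z.1.1 a * (actionUtility G.1.U₂ K.action (K.strategy t) -
              actionUtility G.1.U₂ a (K.strategy t)) := by
          simp only [mul_sub, Finset.sum_sub_distrib, ← Finset.sum_mul, z.1.2.2, one_mul]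
        have h3 := Finset.add_sum_erase _ (fun a => z.1.1 a * (actionUtility G.1.U₂ K.action
          (K.strategy t) - actionUtility G.1.U₂ a (K.strategy t))) (Finset.mem_univ K.action)
        rw [sub_self, mul_zero, zero_add, ← h1] at h3
        have h2 : ∑ a ∈ Finset.univ.erase K.action, z.1.1 a *
            (actionUtility G.1.U₂ K.action (K.strategy t) -
              actionUtility G.1.U₂ a (K.strategy t)) ≤
            ∑ a ∈ Finset.univ.erase K.action, z.1.1 a * (2 * utilityBound G.1.U₂) := by
          refine Finset.sum_le_sum fun a _ => mul_le_mul_of_nonneg_left ?_ (z.1.2.1 a)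
          linarith [le_of_abs_le (abs_actionUtility_le G.1.U₂ K.action (K.strategy t)),
            neg_le_of_abs_le (abs_actionUtility_le G.1.U₂ a (K.strategy t))]
        rw [← Finset.sum_mul] at h2
        linarith
      · simp only [departure, if_neg hz]
        have h1 := le_of_abs_le (abs_actionUtility_le G.1.U₂ K.action (K.strategy t))
        have h2 := neg_le_of_abs_le (abs_mixedUtility_le G.1.U₂ z.1 z.2)
        nlinarith [mul_nonneg hB hx]
  rw [expectedTotal_of_const, expectedTotal_add (boundedMeasurable_mixedUtility _)
    ((hbm.add (boundedMeasurable_departure _)).const_mul _), expectedTotal_const_mul,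
    expectedTotal_add hbm (boundedMeasurable_departure _),
    expectedTotal_sum (Finset.univ.erase K.action)
      fun a : A₁ => boundedMeasurable_apply (A₂ := A₂) a] at h
  refine h.trans ?_
  gcongr

/-- Committing secures the Stackelberg value against regret matching. -/
lemma exists_stackVal₂_sub_le (hL : SuccessfullyLearns (R.external G) G)
    (K : G.1.Commitment (R.learningError G)) (hy : y G = K.strategy) :
    ∃ r : ℕ → ℝ, Tendsto r atTop (𝓝 0) ∧ ∀ T : ℕ, G.1.stackVal₂ - r T ≤
      R.avgUtility₂ T (regretMatchingAlgorithm fb R.family)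
        (committedAlgorithm fb R.family y) G := by
  classical
  set π₁ := regretMatchingAlgorithm fb R.family with hπ₁
  set π₂ := committedAlgorithm fb R.family y with hπ₂
  set B := utilityBound G.1.U₂ with hB
  have hB0 : 0 ≤ B := utilityBound_nonneg _
  set c := 1 + (2 * utilityBound G.1.U₁ + K.gap 0) with hc
  have hc1 : 1 ≤ c := by linarith [utilityBound_nonneg G.1.U₁, K.gap_pos 0]
  set l : ℕ → ℝ := fun T =>
    (T : ℝ)⁻¹ * ∑ t ∈ Finset.range T, actionUtility G.1.U₂ K.action (K.strategy t) -
      2 * B * ((Fintype.card A₁ : ℝ) * (c * (R.learningError G T / K.gap T)) +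
        R.learningError G T) with hl
  have hlim : Tendsto l atTop (𝓝 G.1.stackVal₂) := by
    have := K.tendsto_utility.cesaro.sub ((((K.tendsto_div_gap.const_mul c).const_mul
      (Fintype.card A₁ : ℝ)).add (tendsto_learningError hL)).const_mul (2 * B))
    simpa using this
  -- The shortfall itself serves as error term; it is at most that of `l`, except for `T = 0`.
  refine ⟨fun T => max (G.1.stackVal₂ - R.avgUtility₂ T π₁ π₂ G) 0, ?_, fun T => ?_⟩
  · have hl' : Tendsto (fun T => max (G.1.stackVal₂ - l T) 0) atTop (𝓝 0) := by
      have := (hlim.const_sub G.1.stackVal₂).max (tendsto_const_nhds (x := (0 : ℝ)))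
      simpa using this
    refine squeeze_zero' (.of_forall fun T => le_max_right _ _) ?_ hl'
    filter_upwards [eventually_gt_atTop 0] with T hT
    have hT' : (0 : ℝ) < T := by exact_mod_cast hT
    refine max_le_max_right _ (sub_le_sub_left ?_ _)
    have hD := sum_errorProb_nonneg (R := R) (G := G) T
    have hρ := regretBound_nonneg G.1.U₁ T
    set D := ∑ t ∈ Finset.range T, errorProb (R.external G) G t with hDdef
    have hle : R.learningError G T * T = regretBound G.1.U₁ T + D := by
      rw [learningError, ← hDdef]
      field_simp
    have hX : ∀ a ∈ Finset.univ.erase K.action,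
        R.expectedTotal T π₁ π₂ G (fun _ z => z.1.1 a) ≤
          T * (c * (R.learningError G T / K.gap T)) := by
      intro a ha
      have h1 := gap_mul_expectedTotal_le (fb := fb) K hy T (Finset.ne_of_mem_erase ha)
      have h2 : K.gap T * R.expectedTotal T π₁ π₂ G (fun _ z => z.1.1 a) ≤
          c * (R.learningError G T * T) := by
        rw [hle]
        refine h1.trans ?_
        nlinarith [mul_nonneg (sub_nonneg.2 hc1) hρ]
      have h3 := (le_div_iff₀' (K.gap_pos T)).2 h2
      refine h3.trans (le_of_eq ?_)
      ring
    have hcard : ∑ a ∈ Finset.univ.erase K.action,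
        R.expectedTotal T π₁ π₂ G (fun _ z => z.1.1 a) ≤
          Fintype.card A₁ * (T * (c * (R.learningError G T / K.gap T))) := by
      refine (Finset.sum_le_sum hX).trans ?_
      rw [Finset.sum_const, nsmul_eq_mul]
      refine mul_le_mul_of_nonneg_right (Nat.cast_le.2 (Finset.card_le_univ _)) ?_
      have := learningError_nonneg (R := R) (G := G) T
      have := K.gap_pos T
      positivity
    have h1 := le_expectedTotal_U₂ (fb := fb) K hy T π₁
    rw [← hDdef, ← hB, ← hπ₂] at h1
    rw [avgUtility₂_eq, le_div_iff₀ hT']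
    have h2 : D ≤ R.learningError G T * T := by linarith
    have h3 : 2 * B * (∑ a ∈ Finset.univ.erase K.action,
        R.expectedTotal T π₁ π₂ G (fun _ z => z.1.1 a) + D) ≤
        2 * B * (Fintype.card A₁ * (T * (c * (R.learningError G T / K.gap T))) +
          R.learningError G T * T) := by gcongr
    have h4 : l T * T = ∑ t ∈ Finset.range T, actionUtility G.1.U₂ K.action (K.strategy t) -
        2 * B * (Fintype.card A₁ * (T * (c * (R.learningError G T / K.gap T))) +
          R.learningError G T * T) := by
      simp only [hl]
      rw [sub_mul, mul_comm (T : ℝ)⁻¹, inv_mul_cancel_right₀ hT'.ne']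
      ring
    rw [h4]
    linarith
  · linarith [le_max_left (G.1.stackVal₂ - R.avgUtility₂ T π₁ π₂ G) 0]

/-- Against a committed second player, regret matching is asymptotically a best response. -/
lemma avgUtility₁_sub_le {σ : ℕ → ℝ} (K : G.1.Commitment σ) (hy : y G = K.strategy) (T : ℕ)
    (π₁ : Algorithm₁ fb R.family) :
    R.avgUtility₁ T π₁ (committedAlgorithm fb R.family y) G -
      R.avgUtility₁ T (regretMatchingAlgorithm fb R.family)
        (committedAlgorithm fb R.family y) G ≤
      (4 * utilityBound G.1.U₁ + Fintype.card A₁) * R.learningError G T := by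
  set π₂ := committedAlgorithm fb R.family y with hπ₂
  set B := utilityBound G.1.U₁ with hB
  have hB0 : 0 ≤ B := utilityBound_nonneg _
  rcases Nat.eq_zero_or_pos T with rfl | hT
  · simp [avgUtility₁_eq, learningError]
  have hT' : (0 : ℝ) < T := by exact_mod_cast hT
  have hD0 := sum_errorProb_nonneg (R := R) (G := G) T
  have hρ := regretBound_nonneg G.1.U₁ T
  have hU : ∀ t (y' : MixedStrategy A₂), actionUtility G.1.U₁ K.action (K.strategy t) ≤
      actionUtility G.1.U₁ K.action y' + 2 * B := fun t y' => by
    linarith [le_of_abs_le (abs_actionUtility_le G.1.U₁ K.action (K.strategy t)),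
      neg_le_of_abs_le (abs_actionUtility_le G.1.U₁ K.action y')]
  have hbd : BoundedMeasurable fun t => departure (A₁ := A₁) (y G t) :=
    boundedMeasurable_departure (y G)
  have h1 : R.expectedTotal T π₁ π₂ G (fun _ z => mixedUtility G.1.U₁ z.1 z.2) ≤
      ∑ t ∈ Finset.range T, actionUtility G.1.U₁ K.action (K.strategy t) +
        2 * B * ∑ t ∈ Finset.range T, errorProb (R.external G) G t := by
    have h := expectedTotal_mono (R := R) (T := T) (G := G) (π₁ := π₁) (π₂ := π₂)
      (boundedMeasurable_mixedUtility G.1.U₁)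
      ((boundedMeasurable_actionUtility G.1.U₁ K.action K.strategy).add (hbd.const_mul (2 * B)))
      fun t _ z => by
        by_cases hz : z.2 = y G t
        · simp only [departure, if_pos hz, mul_zero, add_zero]
          rw [mixedUtility_eq, hz, hy]
          calc _ ≤ ∑ a, z.1.1 a * actionUtility G.1.U₁ K.action (K.strategy t) := by
                refine Finset.sum_le_sum fun a _ => mul_le_mul_of_nonneg_left ?_ (z.1.2.1 a)
                by_cases ha : a = K.action
                · rw [ha]
                · linarith [K.add_gap_le t a ha, K.gap_pos t]
            _ = _ := by rw [← Finset.sum_mul, z.1.2.2, one_mul]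
        · simp only [departure, if_neg hz]
          linarith [le_of_abs_le (abs_mixedUtility_le G.1.U₁ z.1 z.2),
            neg_le_of_abs_le (abs_actionUtility_le G.1.U₁ K.action (K.strategy t))]
    rw [expectedTotal_add (boundedMeasurable_actionUtility _ _ _) (hbd.const_mul _),
      expectedTotal_of_const, expectedTotal_const_mul] at h
    have hd := expectedTotal_departure_le (R := R) (T := T) (G := G) (π₁ := π₁) y
    have := mul_le_mul_of_nonneg_left hd (by linarith : 0 ≤ 2 * B)
    linarith
  set π₁' := regretMatchingAlgorithm fb R.family with hπ₁'
  have h2 : ∑ t ∈ Finset.range T, actionUtility G.1.U₁ K.action (K.strategy t) ≤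
      R.expectedTotal T π₁' π₂ G (fun _ z => mixedUtility G.1.U₁ z.1 z.2) +
        Fintype.card A₁ * regretBound G.1.U₁ T +
        2 * B * ∑ t ∈ Finset.range T, errorProb (R.external G) G t := by
    have hsw : BoundedMeasurable fun (_ : ℕ) (z : MixedStrategy A₁ × MixedStrategy A₂) =>
        ∑ a, swapGain G.1.U₁ a K.action z :=
      BoundedMeasurable.sum Finset.univ fun a => boundedMeasurable_swapGain G.1.U₁ a K.action
    have h := expectedTotal_mono (R := R) (T := T) (G := G) (π₁ := π₁') (π₂ := π₂)
      (boundedMeasurable_actionUtility G.1.U₁ K.action K.strategy)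
      (((boundedMeasurable_mixedUtility G.1.U₁).add hsw).add (hbd.const_mul (2 * B)))
      fun t _ z => by
        have he : mixedUtility G.1.U₁ z.1 z.2 + ∑ a, swapGain G.1.U₁ a K.action z =
            actionUtility G.1.U₁ K.action z.2 := by
          simp only [mixedUtility_eq, swapGain, mul_sub, Finset.sum_sub_distrib, ← Finset.sum_mul,
            z.1.2.2]
          ring
        rw [he]
        by_cases hz : z.2 = y G t
        · simp only [departure, if_pos hz, mul_zero, add_zero]
          rw [hz, hy]
        · simp only [departure, if_neg hz, mul_one]
          exact hU t z.2
    rw [expectedTotal_of_const, expectedTotal_add ((boundedMeasurable_mixedUtility _).add hsw)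
      (hbd.const_mul _), expectedTotal_add (boundedMeasurable_mixedUtility _) hsw,
      expectedTotal_const_mul, expectedTotal_sum Finset.univ
        fun a => boundedMeasurable_swapGain G.1.U₁ a K.action] at h
    have hs : ∑ a, R.expectedTotal T π₁' π₂ G (fun _ => swapGain G.1.U₁ a K.action) ≤
        Fintype.card A₁ * regretBound G.1.U₁ T :=
      (Finset.sum_le_sum fun a _ => expectedTotal_swapGain_le a K.action).trans (by simp)
    have hd := expectedTotal_departure_le (R := R) (T := T) (G := G) (π₁ := π₁') y
    have := mul_le_mul_of_nonneg_left hd (by linarith : 0 ≤ 2 * B)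
    linarith
  rw [avgUtility₁_eq, avgUtility₁_eq, ← sub_div, div_le_iff₀ hT']
  have hle : R.learningError G T * T =
      regretBound G.1.U₁ T + ∑ t ∈ Finset.range T, errorProb (R.external G) G t := by
    rw [learningError]
    field_simp
  rw [mul_assoc, hle]
  nlinarith [mul_nonneg hB0 hρ, mul_nonneg (Nat.cast_nonneg (α := ℝ) (Fintype.card A₁)) hD0]

end RepeatedBayesianGame

end Learning

/-! ### The equilibrium -/

/-- Dominated convergence for the payoffs of the meta-game: gains that are asymptotically
nonpositive in every game of positive prior probability are so in expectation. -/
lemma limsup_tsum_sub_tsum_le {ι : Type*} (D : PMF ι) {M : ι → ℝ}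
    (hM : Summable fun i => (D i).toReal * M i) {u u' : ℕ → ι → ℝ} (hu : ∀ T i, |u T i| ≤ M i)
    (hu' : ∀ T i, |u' T i| ≤ M i)
    (h : ∀ i ∈ D.support, ∀ η > 0, ∀ᶠ T in atTop, u' T i - u T i ≤ η) :
    limsup (fun T : ℕ =>
      ((∑' i, (D i).toReal * u' T i - ∑' i, (D i).toReal * u T i : ℝ) : EReal)) atTop ≤ 0 := by
  have hsum : ∀ w : ι → ℝ, (∀ i, |w i| ≤ M i) → Summable fun i => (D i).toReal * w i := by
    intro w hw
    refine Summable.of_norm_bounded hM fun i => ?_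
    rw [Real.norm_eq_abs, abs_mul, abs_of_nonneg ENNReal.toReal_nonneg]
    exact mul_le_mul_of_nonneg_left (hw i) ENNReal.toReal_nonneg
  have hM2 : Summable fun i => (D i).toReal * (2 * M i) := by
    refine (hM.mul_left 2).congr fun i => ?_
    ring
  have hle : ∀ T i, max (u' T i - u T i) 0 ≤ 2 * M i := fun T i =>
    max_le (by linarith [le_of_abs_le (hu' T i), neg_le_of_abs_le (hu T i)])
      (by linarith [(abs_nonneg _).trans (hu T i)])
  have hbound : ∀ T i, ‖(D i).toReal * max (u' T i - u T i) 0‖ ≤ (D i).toReal * (2 * M i) := by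
    intro T i
    rw [Real.norm_eq_abs, abs_of_nonneg (mul_nonneg ENNReal.toReal_nonneg (le_max_right _ _))]
    exact mul_le_mul_of_nonneg_left (hle T i) ENNReal.toReal_nonneg
  have hpt : ∀ i, Tendsto (fun T => (D i).toReal * max (u' T i - u T i) 0) atTop (𝓝 0) := by
    intro i
    by_cases hi : D i = 0
    · simp [hi]
    · have h1 : Tendsto (fun T => max (u' T i - u T i) 0) atTop (𝓝 0) := by
        rw [Metric.tendsto_atTop']
        intro η hη
        obtain ⟨N, hN⟩ := eventually_atTop.1
          (h i ((D.mem_support_iff i).2 hi) (η / 2) (by positivity))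
        refine ⟨N, fun T hT => ?_⟩
        rw [Real.dist_eq, sub_zero, abs_of_nonneg (le_max_right _ _)]
        exact (max_le (hN T hT.le) (by positivity)).trans_lt (by linarith)
      simpa using h1.const_mul (D i).toReal
  have htsum : Tendsto (fun T => ∑' i, (D i).toReal * max (u' T i - u T i) 0) atTop (𝓝 0) := by
    have := tendsto_tsum_of_dominated_convergence hM2 hpt (.of_forall fun T i => hbound T i)
    simpa using this
  have hcoe : Tendsto (fun T => ((∑' i, (D i).toReal * max (u' T i - u T i) 0 : ℝ) : EReal)) atTop
      (𝓝 0) := (continuous_coe_real_ereal.tendsto 0).comp htsum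
  rw [← hcoe.limsup_eq]
  refine limsup_le_limsup (.of_forall fun T => EReal.coe_le_coe_iff.2 ?_)
  rw [← (hsum _ (hu' T)).tsum_sub (hsum _ (hu T))]
  refine Summable.tsum_le_tsum (fun i => ?_) ((hsum _ (hu' T)).sub (hsum _ (hu T)))
    (Summable.of_norm_bounded hM2 (hbound T))
  rw [← mul_sub]
  exact mul_le_mul_of_nonneg_left (le_max_left _ _) ENNReal.toReal_nonneg

lemma summable_prior_mul_utilityBound {ι : Type*} {A₁ : Type u} {A₂ : Type v} [Fintype A₁]
    [Fintype A₂] {p : ι → ℝ} {w : ι → A₁ → A₂ → ℝ}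
    (h : ∀ a b, Summable fun i => p i * |w i a b|) :
    Summable fun i => p i * utilityBound (w i) := by
  simp only [utilityBound, Finset.mul_sum]
  exact summable_sum fun a _ => summable_sum fun b _ => h a b

theorem mainTheorem4 {A₁ : Type u} {A₂ : Type v} [Fintype A₁] [Nonempty A₁] [Fintype A₂]
    [Nonempty A₂] (fb : Feedback) (R : RepeatedBayesianGame A₁ A₂)
    (hint : R.IntegrableUtilities)
    (hdom : ∀ G ∈ R.prior.support, G.1.NoWeaklyDominatedAction)
    (hlearn : ∀ G ∈ R.prior.support, SuccessfullyLearns (R.external G) G) :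
    ∃ (π₁ : Algorithm₁ fb R.family) (π₂ : Algorithm₂ fb R.family),
      R.IsPNE π₁ π₂ ∧
      ∀ G : R.family, G.1.NoWeaklyDominatedAction → SuccessfullyLearns (R.external G) G →
        ∃ r : ℕ → ℝ, Tendsto r atTop (𝓝 0) ∧
          ∀ T : ℕ, G.1.stackVal₂ - r T ≤ R.avgUtility₂ T π₁ π₂ G := by
  classical
  -- In games that are dominated or not learned the second player plays an arbitrary strategy.
  have hy : ∀ G : R.family, ∃ y : ℕ → MixedStrategy A₂,
      G.1.NoWeaklyDominatedAction → SuccessfullyLearns (R.external G) G →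
        ∃ K : G.1.Commitment (R.learningError G), y = K.strategy := by
    intro G
    by_cases hG : G.1.NoWeaklyDominatedAction ∧ SuccessfullyLearns (R.external G) G
    · obtain ⟨K⟩ := G.1.nonempty_commitment hG.1
        (RepeatedBayesianGame.tendsto_learningError hG.2)
        RepeatedBayesianGame.learningError_nonneg
      exact ⟨K.strategy, fun _ _ => ⟨K, rfl⟩⟩
    · exact ⟨fun _ => ⟨_, uniform_mem_stdSimplex⟩, fun h h' => absurd ⟨h, h'⟩ hG⟩
  choose y hy using hy
  have hstack : ∀ G : R.family, G.1.NoWeaklyDominatedAction →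
      SuccessfullyLearns (R.external G) G → ∃ r : ℕ → ℝ, Tendsto r atTop (𝓝 0) ∧
        ∀ T : ℕ, G.1.stackVal₂ - r T ≤ R.avgUtility₂ T (regretMatchingAlgorithm fb R.family)
          (committedAlgorithm fb R.family y) G := by
    intro G hG hL
    obtain ⟨K, hK⟩ := hy G hG hL
    exact RepeatedBayesianGame.exists_stackVal₂_sub_le hL K hK
  refine ⟨regretMatchingAlgorithm fb R.family, committedAlgorithm fb R.family y,
    ⟨fun π₁' => ?_, fun π₂' => ?_⟩, hstack⟩
  · refine limsup_tsum_sub_tsum_le R.prior (summable_prior_mul_utilityBound hint.1)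
      (fun T G => RepeatedBayesianGame.abs_avgUtility₁_le)
      (fun T G => RepeatedBayesianGame.abs_avgUtility₁_le) fun G hG η hη => ?_
    obtain ⟨K, hK⟩ := hy G (hdom G hG) (hlearn G hG)
    have hlim := (RepeatedBayesianGame.tendsto_learningError (hlearn G hG)).const_mul
      (4 * utilityBound G.1.U₁ + Fintype.card A₁)
    rw [mul_zero] at hlim
    filter_upwards [hlim.eventually (gt_mem_nhds hη)] with T hT
    exact (RepeatedBayesianGame.avgUtility₁_sub_le K hK T (π₁' T)).trans hT.le
  · refine limsup_tsum_sub_tsum_le R.prior (summable_prior_mul_utilityBound hint.2)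
      (fun T G => RepeatedBayesianGame.abs_avgUtility₂_le)
      (fun T G => RepeatedBayesianGame.abs_avgUtility₂_le) fun G hG η hη => ?_
    obtain ⟨r, hr, hle⟩ := hstack G (hdom G hG) (hlearn G hG)
    filter_upwards [hr.eventually (gt_mem_nhds (half_pos hη)),
      RepeatedBayesianGame.eventually_avgUtility₂_le G π₂' (half_pos hη)] with T h1 h2
    linarith [hle T]
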